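/- **Setting.** For each sample size $n\ge 1$ let $\mathcal P_n$ be a class of probability distributions $P$ of the sample of size $n$. From the sample one computes an estimator $\hat\beta_n\in\mathbb R^d$, a covariance estimator $\hat\Sigma_n\in\mathbb R^{d\times d}$ and cutoff vectors $\hat c_{k,n}\in\mathbb R^{m_k}$, $k=1,\dots,K$, where $K\ge1$. Let $A_k\in\mathbb R^{m_k\times d}$ be nonrandom matrices all of whose rows are nonzero, and let $l_{post}\in\mathbb R^d$, $l_{post}\ne0$. The conditioning (deviation) event is $\{\hat\beta_n\in\hat{\mathcal B}_n\}$, where $\hat{\mathcal B}_n=\bigcup_{k=1}^K\{b\in\mathbb R^d: A_kb\le\hat c_{k,n}\}$. **Plug-in quantile estimator.** Put $\hat\sigma_n^2=l_{post}'\hat\Sigma_nl_{post}$, $\hat\gamma_n=\hat\Sigma_nl_{post}/\hat\sigma_n^2$, $\hat r_n=\hat\beta_n-\hat\gamma_n\,l_{post}'\hat\beta_n$ and $$\hat Z^-_{k,n}=\max_{j:(A_k\hat\gamma_n)_j<0}\frac{(\hat c_{k,n}-A_k\hat r_n)_j}{(A_k\hat\gamma_n)_j},\qquad \hat Z^+_{k,n}=\min_{j:(A_k\hat\gamma_n)_j>0}\frac{(\hat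 c_{k,n}-A_k\hat r_n)_j}{(A_k\hat\gamma_n)_j},\qquad \hat Z^0_{k,n}=\min_{j:(A_k\hat\gamma_n)_j=0}(\hat c_{k,n}-A_k\hat r_n)_j,$$ with $\max\varnothing=-\infty$ and $\min\varnothing=+\infty$. Let $\hat{\mathcal T}_n$ be the union of the intervals $[\hat Z^-_{k,n},\hat Z^+_{k,n}]$ over those $k$ with $\hat Z^0_{k,n}\ge0$. With $\phi$ the standard normal density let $$F_{TN}(z;\mu,\sigma^2,\mathcal T)=\frac{\int_{-\infty}^z\phi\left(\frac{t-\mu}{\sigma}\right)\mathbf 1\{t\in\mathcal T\}\,dt}{\int_{-\infty}^\infty\phi\left(\frac{t-\mu}{\sigma}\right)\mathbf 1\{t\in\mathcal T\}\,dt}.$$ For $\alpha\in(0,1)$ the estimator $\hat\mu^*_{\alpha,n}$ solves, on the event $\hat\beta_n\in\hat{\mathcal B}_n$, $$F_{TN}(l_{post}'\hat\beta_n;\hat\mu^*_{\alpha,n},\hat\sigma^2_n,\hat{\mathcal T}_n)=1-\alpha$$ whenever this equation has a solution; its values elsewhere are arbitrary. **Assumptions.** 1. There are vectors $\beta(P)\in\mathbb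 R^d$ and symmetric matrices $\Sigma(P)\in\mathbb R^{d\times d}$ such that, with $\xi_P\sim N(0,\Sigma(P))$ and $BL_1$ the set of functions $f:\mathbb R^d\to\mathbb R$ with $|f|\le1$ and Lipschitz constant at most $1$, $$\lim_{n\to\infty}\sup_{P\in\mathcal P_n}\sup_{f\in BL_1}\left|E_P\left[f\left(\sqrt n(\hat\beta_n-\beta(P))\right)\right]-E[f(\xi_P)]\right|=0,$$ and there is a finite $\bar\lambda>0$ with $1/\bar\lambda\le\lambda_{\min}(\Sigma(P))\le\lambda_{\max}(\Sigma(P))\le\bar\lambda$ for all $P\in\bigcup_{n\ge1}\mathcal P_n$. 2. For each $\varepsilon>0$, $\lim_{n\to\infty}\sup_{P\in\mathcal P_n}P(\|n\hat\Sigma_n-\Sigma(P)\|>\varepsilon)=0$. 3. For each $k$ there are vectors $c_k(P)\in\mathbb R^{m_k}$ such that for each $\varepsilon>0$, $\lim_{n\to\infty}\sup_{P\in\mathcal P_n}P(\|\sqrt n\,\hat c_{k,n}-c_k(P)\|>\varepsilon)=0$, and there is a finite $\bar\lambda_c>0$ with $\|c_k(P)\|\le\bar\lambda_c$ for all $P\in\bigcup_{n\ge1}\mathcal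 P_n$ and all $k$. **Conclusion.** For every $\alpha\in(0,1)$, $$\lim_{n\to\infty}\sup_{P\in\mathcal P_n}\left|P\left(l_{post}'\beta(P)\le\hat\mu^*_{\alpha,n}\,\middle|\,\hat\beta_n\in\hat{\mathcal B}_n\right)-\alpha\right|P(\hat\beta_n\in\hat{\mathcal B}_n)=0.$$ Moreover, the confidence intervals $CI^*_{\alpha,n}=[\hat\mu^*_{\alpha/2,n},\hat\mu^*_{1-\alpha/2,n}]$ satisfy, for every $\alpha\in(0,1)$, $$\lim_{n\to\infty}\sup_{P\in\mathcal P_n}\left|P\left(l_{post}'\beta(P)\in CI^*_{\alpha,n}\,\middle|\,\hat\beta_n\in\hat{\mathcal B}_n\right)-(1-\alpha)\right|P(\hat\beta_n\in\hat{\mathcal B}_n)=0,$$ and the point estimators $\hat\mu^*_{1/2,n}$ satisfy $$\lim_{n\to\infty}\sup_{P\in\mathcal P_n}\left|P\left(l_{post}'\beta(P)\le\hat\mu^*_{1/2,n}\,\middle|\,\hat\beta_n\in\hat{\mathcal B}_n\right)-\tfrac12\right|P(\hat\beta_n\in\hat{\mathcal B}_n)=0.$$ (Products in which $P(\hat\beta_n\in\hat{\mathcal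 B}_n)=0$ are read as $0$.) -/

import Mathlib

open MeasureTheory ProbabilityTheory Filter Topology

open scoped Matrix ENNReal

noncomputable section

/-! ### The plug-in conditional quantile estimator -/

/-- The union over `k` of the polyhedra `{b : A k b ≤ c k}` (componentwise inequalities). -/
def polyhedralUnion {d K : ℕ} {m : Fin K → ℕ} (A : ∀ k, Matrix (Fin (m k)) (Fin d) ℝ)
    (c : ∀ k, EuclideanSpace ℝ (Fin (m k))) : Set (EuclideanSpace ℝ (Fin d)) :=
  ⋃ k, {b | ∀ j, (A k *ᵥ b.ofLp) j ≤ c k j}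

/-- The variance `l' S l` of the linear combination `l' b` induced by the covariance matrix `S`. -/
def combVariance {d : ℕ} (l : Fin d → ℝ) (S : Matrix (Fin d) (Fin d) ℝ) : ℝ :=
  l ⬝ᵥ (S *ᵥ l)

/-- The regression coefficient `γ = S l / (l' S l)`. -/
def regCoef {d : ℕ} (l : Fin d → ℝ) (S : Matrix (Fin d) (Fin d) ℝ) : Fin d → ℝ :=
  (combVariance l S)⁻¹ • (S *ᵥ l)

/-- The residual `r = b - γ (l' b)`. -/
def regResidual {d : ℕ} (l : Fin d → ℝ) (S : Matrix (Fin d) (Fin d) ℝ)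
    (b : EuclideanSpace ℝ (Fin d)) : Fin d → ℝ :=
  b.ofLp - (l ⬝ᵥ b.ofLp) • regCoef l S

/-- `Z⁻ = max {(c_j - (A r)_j) / (A γ)_j : (A γ)_j < 0}`, equal to `-∞` if there is no such `j`. -/
def truncLower {d p : ℕ} (A : Matrix (Fin p) (Fin d) ℝ) (c : EuclideanSpace ℝ (Fin p))
    (γ r : Fin d → ℝ) : EReal :=
  ⨆ (j : Fin p) (_ : (A *ᵥ γ) j < 0), (((c j - (A *ᵥ r) j) / (A *ᵥ γ) j : ℝ) : EReal)

/-- `Z⁺ = min {(c_j - (A r)_j) / (A γ)_j : (A γ)_j > 0}`, equal to `+∞` if there is no such `j`. -/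
def truncUpper {d p : ℕ} (A : Matrix (Fin p) (Fin d) ℝ) (c : EuclideanSpace ℝ (Fin p))
    (γ r : Fin d → ℝ) : EReal :=
  ⨅ (j : Fin p) (_ : 0 < (A *ᵥ γ) j), (((c j - (A *ᵥ r) j) / (A *ᵥ γ) j : ℝ) : EReal)

/-- `Z⁰ = min {c_j - (A r)_j : (A γ)_j = 0}`, equal to `+∞` if there is no such `j`. -/
def truncZero {d p : ℕ} (A : Matrix (Fin p) (Fin d) ℝ) (c : EuclideanSpace ℝ (Fin p))
    (γ r : Fin d → ℝ) : EReal :=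
  ⨅ (j : Fin p) (_ : (A *ᵥ γ) j = 0), ((c j - (A *ᵥ r) j : ℝ) : EReal)

/-- The truncation set: the union over `k` of the intervals `[Z⁻_k, Z⁺_k]`, where the `k`-th one
is replaced by the empty set if `Z⁰_k < 0`. -/
def truncSet {d K : ℕ} {m : Fin K → ℕ} (A : ∀ k, Matrix (Fin (m k)) (Fin d) ℝ)
    (l : Fin d → ℝ) (S : Matrix (Fin d) (Fin d) ℝ) (c : ∀ k, EuclideanSpace ℝ (Fin (m k)))
    (b : EuclideanSpace ℝ (Fin d)) : Set ℝ :=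
  ⋃ k, {t : ℝ |
    0 ≤ truncZero (A k) (c k) (regCoef l S) (regResidual l S b) ∧
    truncLower (A k) (c k) (regCoef l S) (regResidual l S b) ≤ (t : EReal) ∧
    (t : EReal) ≤ truncUpper (A k) (c k) (regCoef l S) (regResidual l S b)}

/-- `F_TN(z; μ, v, T)`: the CDF at `z` of the normal distribution with mean `μ` and variance `v`
truncated to `T`, a ratio of integrals of the standard normal density `φ((t - μ) / √v)`. -/
def truncNormalCDF (z μ v : ℝ) (T : Set ℝ) : ℝ :=
  (∫ t in Set.Iic z, T.indicator (fun t => gaussianPDFReal 0 1 ((t - μ) / √v)) t) /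
    ∫ t, T.indicator (fun t => gaussianPDFReal 0 1 ((t - μ) / √v)) t

/-- `mu` is a version of the plug-in level-`α` quantile estimator built from the estimator `bhat`,
the covariance estimator `Shat` and the cutoffs `chat`: at every data point at which `bhat` lies in
the union of polyhedra, `mu` solves `F_TN(l' bhat; μ, l' Shat l, T) = 1 - α` in `μ`.
This determines `mu` where the equation has a unique solution; nothing is
required of `mu` where it has none (for example where `T` is a single point), nor outside the
conditioning event. -/
def IsPlugInQuantile {X : Type*} {d K : ℕ} {m : Fin K → ℕ}
    (A : ∀ k, Matrix (Fin (m k)) (Fin d) ℝ) (l : Fin d → ℝ)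
    (bhat : X → EuclideanSpace ℝ (Fin d)) (Shat : X → Matrix (Fin d) (Fin d) ℝ)
    (chat : X → ∀ k, EuclideanSpace ℝ (Fin (m k))) (α : ℝ) (mu : X → ℝ) : Prop :=
  ∀ x, bhat x ∈ polyhedralUnion A (chat x) →
    (∃ u : ℝ, truncNormalCDF (l ⬝ᵥ (bhat x).ofLp) u (combVariance l (Shat x))
      (truncSet A l (Shat x) (chat x) (bhat x)) = 1 - α) →
    truncNormalCDF (l ⬝ᵥ (bhat x).ofLp) (mu x) (combVariance l (Shat x))
      (truncSet A l (Shat x) (chat x) (bhat x)) = 1 - α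

/-! ### The three assumptions -/

/-- The functions bounded by one in absolute value and with Lipschitz constant at most one. -/
def BLOne (E : Type*) [PseudoEMetricSpace E] : Set (E → ℝ) :=
  {f | (∀ x, |f x| ≤ 1) ∧ LipschitzWith 1 f}

/-- `√n (bhat_n - β(P))` converges to `N(0, Σ(P))` in bounded Lipschitz metric, uniformly in
`P ∈ cP n`, and the eigenvalues of the symmetric matrices `Σ(P)` lie in a fixed `[1 / lam, lam]`. -/
def UniformAsymptoticNormality {X : ℕ → Type*} [∀ n, MeasurableSpace (X n)] {d : ℕ}
    (cP : ∀ n, Set (ProbabilityMeasure (X n)))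
    (bhat : ∀ n, X n → EuclideanSpace ℝ (Fin d))
    (β : ∀ n, ProbabilityMeasure (X n) → EuclideanSpace ℝ (Fin d))
    (S : ∀ n, ProbabilityMeasure (X n) → Matrix (Fin d) (Fin d) ℝ) : Prop :=
  Tendsto (fun n : ℕ => ⨆ P ∈ cP n, ⨆ f ∈ BLOne (EuclideanSpace ℝ (Fin d)),
      ENNReal.ofReal |(∫ x, f (√(n : ℝ) • bhat n x - √(n : ℝ) • β n P) ∂(P : Measure (X n))) -
        ∫ y, f y ∂(multivariateGaussian 0 (S n P))|) atTop (𝓝 0) ∧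
  ∃ lam : ℝ, 0 < lam ∧ ∀ n, 1 ≤ n → ∀ P ∈ cP n,
    ∃ h : (S n P).IsHermitian, ∀ i, 1 / lam ≤ h.eigenvalues i ∧ h.eigenvalues i ≤ lam

/-- `n Shat_n` is consistent for `Σ(P)` in spectral norm, uniformly in `P ∈ cP n`. -/
def UniformCovarianceConsistency {X : ℕ → Type*} [∀ n, MeasurableSpace (X n)] {d : ℕ}
    (cP : ∀ n, Set (ProbabilityMeasure (X n)))
    (Shat : ∀ n, X n → Matrix (Fin d) (Fin d) ℝ)
    (S : ∀ n, ProbabilityMeasure (X n) → Matrix (Fin d) (Fin d) ℝ) : Prop :=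
  ∀ ε : ℝ, 0 < ε →
    Tendsto (fun n : ℕ => ⨆ P ∈ cP n, (P : Measure (X n))
      {x | ε < ‖Matrix.toEuclideanCLM (𝕜 := ℝ) ((n : ℝ) • Shat n x - S n P)‖}) atTop (𝓝 0)

/-- `√n chat_{k,n}` is consistent for `c_k(P)`, uniformly in `P ∈ cP n`, for every `k`, and the
vectors `c_k(P)` are bounded uniformly in `P` and `k`. -/
def UniformCutoffConsistency {X : ℕ → Type*} [∀ n, MeasurableSpace (X n)] {K : ℕ}
    {m : Fin K → ℕ} (cP : ∀ n, Set (ProbabilityMeasure (X n)))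
    (chat : ∀ n, X n → ∀ k, EuclideanSpace ℝ (Fin (m k)))
    (c : ∀ n, ProbabilityMeasure (X n) → ∀ k, EuclideanSpace ℝ (Fin (m k))) : Prop :=
  (∀ k, ∀ ε : ℝ, 0 < ε →
    Tendsto (fun n : ℕ => ⨆ P ∈ cP n, (P : Measure (X n))
      {x | ε < ‖√(n : ℝ) • chat n x k - c n P k‖}) atTop (𝓝 0)) ∧
  ∃ lam : ℝ, 0 < lam ∧ ∀ n, 1 ≤ n → ∀ P ∈ cP n, ∀ k, ‖c n P k‖ ≤ lam

/-! ### Uniform asymptotic validity -/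

/-- `|P(E | B) - p| · P(B)`. -/
def weightedCondError {X : Type*} [MeasurableSpace X] (P : Measure X) (E B : Set X) (p : ℝ) : ℝ :=
  |(ProbabilityTheory.cond P B).real E - p| * P.real B

/-- `sup_{P ∈ cP n} |P(E n P | B n) - p| · P(B n) → 0` as `n → ∞`. -/
def UniformCondLimit {X : ℕ → Type*} [∀ n, MeasurableSpace (X n)]
    (cP : ∀ n, Set (ProbabilityMeasure (X n)))
    (E : ∀ n, ProbabilityMeasure (X n) → Set (X n)) (B : ∀ n, Set (X n)) (p : ℝ) : Prop :=
  Tendsto (fun n : ℕ => ⨆ P ∈ cP n,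
    ENNReal.ofReal (weightedCondError (P : Measure (X n)) (E n P) (B n) p)) atTop (𝓝 0)

end

/-! The proof passes to a limit experiment in which the statement is an exact identity, and shows
that the events concerned are stable under that passage.

In the coordinates `y = √n (β̂ - β(P))` the conditioning event is a union of polyhedra with cutoffs
`√n ĉ - √n A β(P)`. The plug-in truncation set is the trace of that union on the line through `y`
with direction `γ̂`, measured by `l' y` (`truncSet_eq_lineSet`, `lineNumer_scaled`). Let `N` and `D`
be the masses that a centred normal law gives to the part of this trace up to `l' y` and to the
whole trace. Then `N / D` is the truncated normal distribution function at the true mean `l' β(P)`.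
Tilting the mean multiplies the density by an exponential, so this function decreases in the mean
and takes every value in `(0, 1)` once both sides of the data point carry mass. Hence `N > (1 - α)
D` forces `l' β(P) < μ̂*_α`, and `N < (1 - α) D` forces the reverse
(`mul_lineDenom_lt_lineNumer_imp`).

In the limit `y ~ N(0, S₀)`, the residual is independent of `l' y`, so on each line the probability
integral transform makes `N / D` uniform: for the limiting union `Q`, `P(y ∈ Q, N ≤ z D) = z P(y ∈
Q)` (`multivariateGaussian_lineNumer_le`). In particular ties, and the degenerate values `0` and
`1`, are null.

Uniformity in `P` is handled by ultrafilters on pairs `(n, P)`. Along each of them the covariances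
and `c_k(P)` converge by compactness. The shifts `√n A β(P)` may be unbounded, but they converge in
the compact space `EReal`; an infinite cutoff either removes a constraint or makes its polyhedron
empty. If every polyhedron disappears, both limiting probabilities are zero, which is why the weight
`P(β̂ ∈ B̂)` suffices. Almost every limit point is off the polyhedral boundaries, where `N` and `D`
are jointly continuous in `y`, direction, variance and cutoffs. The mapping theorem
`tendsto_measureReal_of_mem_nhds` then transfers the limit identity. -/

noncomputable section

/-! ### Convergence in probability along a filter -/

/-- `a i` converges to the constant `c` in probability along `L`, where the maps `a i` may live on
different measure spaces. -/
def TendstoInProb {ι : Type*} {Ω : ι → Type*} [∀ i, MeasurableSpace (Ω i)] {H : Type*}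
    [TopologicalSpace H] (L : Filter ι) (μ : ∀ i, Measure (Ω i)) (a : ∀ i, Ω i → H) (c : H) :
    Prop :=
  ∀ N ∈ 𝓝 c, Tendsto (fun i => μ i {x | a i x ∉ N}) L (𝓝 0)

namespace TendstoInProb

variable {ι : Type*} {Ω : ι → Type*} [∀ i, MeasurableSpace (Ω i)] {L : Filter ι}
  {μ : ∀ i, Measure (Ω i)} {H H' : Type*} [TopologicalSpace H] [TopologicalSpace H']

theorem comp {a : ∀ i, Ω i → H} {c : H} (h : TendstoInProb L μ a c) {f : H → H'}
    (hf : ContinuousAt f c) : TendstoInProb L μ (fun i x => f (a i x)) (f c) :=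
  fun _ hN => h _ (hf hN)

theorem const {a : ι → H} {c : H} (h : Tendsto a L (𝓝 c)) :
    TendstoInProb L μ (fun i _ => a i) c := by
  intro N hN
  refine tendsto_const_nhds.congr' ?_
  filter_upwards [h hN] with i hi
  have : {x : Ω i | a i ∉ N} = ∅ := by
    ext x; simpa using hi
  rw [this, measure_empty]

theorem prodMk {a : ∀ i, Ω i → H} {c : H} {a' : ∀ i, Ω i → H'} {c' : H'}
    (h : TendstoInProb L μ a c) (h' : TendstoInProb L μ a' c') :
    TendstoInProb L μ (fun i x => (a i x, a' i x)) (c, c') := by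
  intro N hN
  obtain ⟨u, hu, v, hv, huv⟩ := mem_nhds_prod_iff.1 hN
  have hs := (h u hu).add (h' v hv)
  rw [add_zero] at hs
  refine tendsto_of_tendsto_of_tendsto_of_le_of_le tendsto_const_nhds hs (fun _ => zero_le)
    fun i => (measure_mono fun x hx => ?_).trans (measure_union_le _ _)
  by_contra hx'
  simp only [Set.mem_union, Set.mem_ofPred_eq, not_or, not_not] at hx'
  exact hx (huv hx')

theorem pi {κ : Type*} [Finite κ] {F : κ → Type*} [∀ k, TopologicalSpace (F k)]
    {a : ∀ i, Ω i → ∀ k, F k} {c : ∀ k, F k}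
    (h : ∀ k, TendstoInProb L μ (fun i x => a i x k) (c k)) : TendstoInProb L μ a c := by
  classical
  cases nonempty_fintype κ
  intro N hN
  rw [nhds_pi, mem_pi'] at hN
  obtain ⟨I, t, ht, hsub⟩ := hN
  have hs := tendsto_finsetSum I fun k _ => h k (t k) (ht k)
  rw [Finset.sum_const_zero] at hs
  refine tendsto_of_tendsto_of_tendsto_of_le_of_le tendsto_const_nhds hs (fun _ => zero_le)
    fun i => (measure_mono fun x hx => ?_).trans
      (measure_biUnion_finset_le I fun k => {x | a i x k ∉ t k})
  by_contra hx'
  simp only [Set.mem_iUnion, Set.mem_ofPred_eq, not_exists, not_not] at hx'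
  exact hx (hsub fun k hk => hx' k hk)

theorem of_norm_sub {V : Type*} [SeminormedAddCommGroup V] {a : ∀ i, Ω i → V} {b : ι → V} {c : V}
    (h : ∀ ε : ℝ, 0 < ε → Tendsto (fun i => μ i {x | ε < ‖a i x - b i‖}) L (𝓝 0))
    (hb : Tendsto b L (𝓝 c)) : TendstoInProb L μ a c := by
  intro N hN
  obtain ⟨ε, hε, hsub⟩ := Metric.mem_nhds_iff.1 hN
  refine tendsto_of_tendsto_of_tendsto_of_le_of_le' tendsto_const_nhds (h (ε / 2) (by positivity))
    (Eventually.of_forall fun _ => zero_le) ?_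
  filter_upwards [hb (Metric.ball_mem_nhds c (show 0 < ε / 2 by positivity))] with i hi
  refine measure_mono fun x hx => ?_
  by_contra hx'
  simp only [Set.mem_ofPred_eq, not_lt] at hx'
  refine hx (hsub ?_)
  rw [Set.mem_preimage, Metric.mem_ball, dist_eq_norm] at hi
  rw [Metric.mem_ball, dist_eq_norm]
  calc ‖a i x - c‖ = ‖(a i x - b i) + (b i - c)‖ := by abel_nf
    _ ≤ ‖a i x - b i‖ + ‖b i - c‖ := norm_add_le _ _
    _ < ε := by linarith

end TendstoInProb

/-! ### A mapping theorem -/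

section Mapping

theorem isOpen_setOf_mem_nhds_prodMk {E H : Type*} [TopologicalSpace E]
    [TopologicalSpace H] (G : Set (E × H)) (θ₀ : H) :
    IsOpen {y : E | G ∈ 𝓝 (y, θ₀)} := by
  have : {y : E | G ∈ 𝓝 (y, θ₀)} = (fun y => (y, θ₀)) ⁻¹' interior G := by
    ext y; simp [mem_interior_iff_mem_nhds]
  rw [this]
  exact isOpen_interior.preimage (by fun_prop)

variable {ι : Type*} {Ω : ι → Type*} [∀ i, MeasurableSpace (Ω i)] {L : Filter ι}
  {μ : ∀ i, Measure (Ω i)} [∀ i, IsProbabilityMeasure (μ i)]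
  {E : Type*} [PseudoMetricSpace E] [MeasurableSpace E] [BorelSpace E]
  {ν : Measure E} [IsProbabilityMeasure ν]
  {Y : ∀ i, Ω i → E}

/-- A portmanteau lower bound that uses only bounded Lipschitz test functions: a thickened indicator
of `K`, supported in `V`, lies between the indicators of `K` and `V`. -/
theorem eventually_lt_measureReal_of_isCompact_subset (hY : ∀ i, Measurable (Y i))
    (hconv : ∀ f ∈ BLOne E, Tendsto (fun i => ∫ x, f (Y i x) ∂μ i) L (𝓝 (∫ y, f y ∂ν)))
    {K V : Set E} (hK : IsCompact K) (hKm : MeasurableSet K) (hV : IsOpen V) (hKV : K ⊆ V) {r : ℝ}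
    (hr : r < ν.real K) :
    ∀ᶠ i in L, r < (μ i).real {x | Y i x ∈ V} := by
  obtain ⟨δ, hδ, hδV⟩ := hK.exists_thickening_subset_open hV hKV
  set f : E → ℝ := fun y => thickenedIndicator hδ K y with hf
  have hf0 : ∀ y, 0 ≤ f y := fun y => NNReal.coe_nonneg _
  have hf1 : ∀ y, f y ≤ 1 := fun y => by
    have := thickenedIndicator_le_one hδ K y
    exact_mod_cast this
  have hfc : Continuous f := NNReal.continuous_coe.comp (thickenedIndicator hδ K).continuous
  -- The thickened indicator is `δ⁻¹`-Lipschitz and bounded by `1`; the factor `min 1 δ` brings both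
  -- constants down to at most `1`.
  set c : ℝ := min 1 δ with hc
  have hcpos : 0 < c := lt_min one_pos hδ
  have hg : (fun y => c * f y) ∈ BLOne E := by
    refine ⟨fun y => ?_, ?_⟩
    · rw [abs_of_nonneg (mul_nonneg hcpos.le (hf0 y))]
      exact mul_le_one₀ (min_le_left _ _) (hf0 y) (hf1 y)
    · have hl := lipschitzWith_thickenedIndicator hδ K
      refine LipschitzWith.of_dist_le_mul fun x y => ?_
      have h1 := hl.dist_le_mul x y
      rw [NNReal.dist_eq] at h1
      have h2 : (δ.toNNReal⁻¹ : NNReal) = δ⁻¹ := by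
        rw [NNReal.coe_inv, Real.coe_toNNReal _ hδ.le]
      rw [h2] at h1
      rw [Real.dist_eq, ← mul_sub, abs_mul, abs_of_pos hcpos, NNReal.coe_one, one_mul]
      calc c * |f x - f y| ≤ δ * (δ⁻¹ * dist x y) :=
            mul_le_mul (min_le_right _ _) h1 (abs_nonneg _) hδ.le
        _ = dist x y := by field_simp
  have hfint : Integrable f ν := by
    refine Integrable.of_bound hfc.aestronglyMeasurable 1 (Eventually.of_forall fun y => ?_)
    rw [Real.norm_eq_abs, abs_of_nonneg (hf0 y)]
    exact hf1 y
  have hlim : r < ∫ y, f y ∂ν := by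
    refine hr.trans_le ?_
    rw [← integral_indicator_one hKm]
    refine integral_mono ((integrable_const (1 : ℝ)).indicator hKm) hfint fun y => ?_
    by_cases hy : y ∈ K
    · have : f y = 1 := by rw [hf]; simp only; rw [thickenedIndicator_one hδ K hy]; rfl
      simp [hy, this]
    · simpa [hy] using hf0 y
  have hgl := hconv _ hg
  simp_rw [integral_const_mul] at hgl
  filter_upwards [hgl.eventually_const_lt (mul_lt_mul_of_pos_left hlim hcpos)] with i hi
  have hi' := lt_of_mul_lt_mul_left hi hcpos.le
  refine hi'.trans_le ?_
  have hms : MeasurableSet {x | Y i x ∈ V} := hY i hV.measurableSet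
  rw [← integral_indicator_one hms]
  refine integral_mono ?_ ((integrable_const (1 : ℝ)).indicator hms) fun x => ?_
  · refine Integrable.of_bound (hfc.measurable.comp (hY i)).aestronglyMeasurable 1
      (Eventually.of_forall fun y => ?_)
    rw [Real.norm_eq_abs, abs_of_nonneg (hf0 _)]
    exact hf1 _
  · by_cases hx : Y i x ∈ V
    · simpa [hx] using hf1 _
    · have : Y i x ∉ Metric.thickening δ K := fun h => hx (hδV h)
      have h0 : f (Y i x) = 0 := by rw [hf]; simp only; rw [thickenedIndicator_zero hδ K this]; rfl
      simp [hx, h0]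

variable {H : Type*} [TopologicalSpace H] {θ : ∀ i, Ω i → H} {θ₀ : H}

/-- Inner regularity gives a compact set of good limit points, and the tube lemma gives a product
neighbourhood `V × N` inside `G`. Failure of `G` while `Y i` is in `V` then forces `θ i ∉ N`, an
event of vanishing probability. -/
theorem eventually_lt_measureReal_of_mem_nhds [ν.Regular] [T2Space E] (hY : ∀ i, Measurable (Y i))
    (hconv : ∀ f ∈ BLOne E, Tendsto (fun i => ∫ x, f (Y i x) ∂μ i) L (𝓝 (∫ y, f y ∂ν)))
    (hθ : TendstoInProb L μ θ θ₀) (G : Set (E × H)) {r : ℝ}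
    (hr : r < ν.real {y | G ∈ 𝓝 (y, θ₀)}) :
    ∃ V : Set E, IsOpen V ∧ (∀ᶠ i in L, r < (μ i).real {x | Y i x ∈ V}) ∧
      Tendsto (fun i => (μ i).real {x | Y i x ∈ V ∧ (Y i x, θ i x) ∉ G}) L (𝓝 0) := by
  rcases lt_or_ge r 0 with h0 | h0
  · exact ⟨∅, isOpen_empty, Eventually.of_forall fun i => by simpa using h0, by simpa using tendsto_const_nhds⟩
  have hr' : ENNReal.ofReal r < ν {y | G ∈ 𝓝 (y, θ₀)} := by
    rw [← ofReal_measureReal]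
    exact (ENNReal.ofReal_lt_ofReal_iff_of_nonneg h0).2 hr
  obtain ⟨K, hKG, hK, hrK⟩ := (isOpen_setOf_mem_nhds_prodMk G θ₀).exists_lt_isCompact hr'
  have hsub : K ×ˢ {θ₀} ⊆ interior G := by
    rintro ⟨y, t⟩ ⟨hy, ht⟩
    rw [Set.mem_singleton_iff] at ht
    subst ht
    exact mem_interior_iff_mem_nhds.2 (hKG hy)
  obtain ⟨V, N, hV, hN, hKV, hθN, hVN⟩ :=
    generalized_tube_lemma hK isCompact_singleton isOpen_interior hsub
  refine ⟨V, hV, eventually_lt_measureReal_of_isCompact_subset hY hconv hK hK.measurableSet hV hKV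
    ?_, ?_⟩
  · rw [measureReal_def]
    exact (ENNReal.ofReal_lt_iff_lt_toReal h0 (measure_ne_top _ _)).1 hrK
  · have hN' := hθ N (hN.mem_nhds (hθN rfl))
    have hN'' := (ENNReal.tendsto_toReal ENNReal.zero_ne_top).comp hN'
    refine tendsto_of_tendsto_of_tendsto_of_le_of_le tendsto_const_nhds hN''
      (fun _ => measureReal_nonneg) fun i => ?_
    refine measureReal_mono (fun x hx => ?_) (measure_ne_top _ _)
    exact fun h => hx.2 (interior_subset (hVN ⟨hx.1, h⟩))

/-- If the events `W i` contain `{(Y i, θ i) ∈ G₁}` and avoid `{(Y i, θ i) ∈ G₀}`, where `Y i`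
converges in law to `ν` and `θ i` in probability to `θ₀`, and `ν`-almost every `(y, θ₀)` is interior
to `G₁` or `G₀`, then the probabilities of the events `W i` converge. The events and the maps `θ i`
need not be measurable. -/
theorem tendsto_measureReal_of_mem_nhds [ν.Regular] [T2Space E] (hY : ∀ i, Measurable (Y i))
    (hconv : ∀ f ∈ BLOne E, Tendsto (fun i => ∫ x, f (Y i x) ∂μ i) L (𝓝 (∫ y, f y ∂ν)))
    (hθ : TendstoInProb L μ θ θ₀) {W : ∀ i, Set (Ω i)} {G₁ G₀ : Set (E × H)}
    (h₁ : ∀ᶠ i in L, ∀ x, (Y i x, θ i x) ∈ G₁ → x ∈ W i)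
    (h₀ : ∀ᶠ i in L, ∀ x, (Y i x, θ i x) ∈ G₀ → x ∉ W i)
    (hν : ∀ᵐ y ∂ν, G₁ ∈ 𝓝 (y, θ₀) ∨ G₀ ∈ 𝓝 (y, θ₀)) :
    Tendsto (fun i => (μ i).real (W i)) L (𝓝 (ν.real {y | G₁ ∈ 𝓝 (y, θ₀)})) := by
  rw [tendsto_order]
  constructor
  · intro r hr
    obtain ⟨r', hr1, hr2⟩ := exists_between hr
    obtain ⟨V, hV, hVr, hV0⟩ := eventually_lt_measureReal_of_mem_nhds hY hconv hθ G₁ hr2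
    filter_upwards [hVr, hV0.eventually_lt_const (sub_pos.2 hr1), h₁] with i hi1 hi2 hi3
    have : (μ i).real {x | Y i x ∈ V} ≤
        (μ i).real (W i) + (μ i).real {x | Y i x ∈ V ∧ (Y i x, θ i x) ∉ G₁} := by
      refine (measureReal_mono (fun x hx => ?_) (measure_ne_top _ _)).trans
        (measureReal_union_le _ _)
      by_cases hG : (Y i x, θ i x) ∈ G₁
      · exact Or.inl (hi3 x hG)
      · exact Or.inr ⟨hx, hG⟩
    linarith
  · intro r hr
    obtain ⟨r', hr1, hr2⟩ := exists_between hr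
    have hle : 1 - ν.real {y | G₁ ∈ 𝓝 (y, θ₀)} ≤ ν.real {y | G₀ ∈ 𝓝 (y, θ₀)} := by
      have : (1 : ℝ) ≤ ν.real {y | G₁ ∈ 𝓝 (y, θ₀)} + ν.real {y | G₀ ∈ 𝓝 (y, θ₀)} := by
        refine le_trans ?_ (measureReal_union_le _ _)
        have h1 : ν ({y | G₁ ∈ 𝓝 (y, θ₀)} ∪ {y | G₀ ∈ 𝓝 (y, θ₀)}) = ν Set.univ :=
          measure_congr (by filter_upwards [hν] with y hy using eq_true hy |>.trans (by rfl))
        rw [measureReal_def, h1]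
        simp
      linarith
    obtain ⟨V, hV, hVr, hV0⟩ := eventually_lt_measureReal_of_mem_nhds hY hconv hθ G₀
      (r := 1 - r') (by linarith)
    filter_upwards [hVr, hV0.eventually_lt_const (sub_pos.2 hr2), h₀] with i hi1 hi2 hi3
    have hms : MeasurableSet {x | Y i x ∈ V} := hY i hV.measurableSet
    have hc : (μ i).real {x | Y i x ∈ V}ᶜ = 1 - (μ i).real {x | Y i x ∈ V} :=
      probReal_compl_eq_one_sub hms
    have : (μ i).real (W i) ≤ (μ i).real {x | Y i x ∈ V}ᶜ +
        (μ i).real {x | Y i x ∈ V ∧ (Y i x, θ i x) ∉ G₀} := by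
      refine (measureReal_mono (fun x hx => ?_) (measure_ne_top _ _)).trans
        (measureReal_union_le _ _)
      by_cases hVx : Y i x ∈ V
      · exact Or.inr ⟨hVx, fun hG => hi3 x hG hx⟩
      · exact Or.inl hVx
    linarith

end Mapping

/-! ### Centred Gaussian measures -/

section Gaussian

open scoped MatrixOrder

theorem sub_smul_one_posSemidef {n : Type*} [Fintype n] [DecidableEq n] {S : Matrix n n ℝ}
    (hS : S.IsHermitian) {a : ℝ} (ha : ∀ i, a ≤ hS.eigenvalues i) :
    (S - a • 1).PosSemidef := by
  rw [← Matrix.le_iff]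
  have := (algebraMap_le_iff_le_spectrum (R := ℝ) (r := a) (a := S) hS.isSelfAdjoint).2 (by
    rw [hS.spectrum_real_eq_range_eigenvalues]
    rintro _ ⟨i, rfl⟩
    exact ha i)
  rwa [Algebra.algebraMap_eq_smul_one] at this

theorem smul_one_sub_posSemidef {n : Type*} [Fintype n] [DecidableEq n] {S : Matrix n n ℝ}
    (hS : S.IsHermitian) {b : ℝ} (hb : ∀ i, hS.eigenvalues i ≤ b) :
    (b • 1 - S).PosSemidef := by
  rw [← Matrix.le_iff]
  have := (le_algebraMap_iff_spectrum_le (R := ℝ) (r := b) (a := S) hS.isSelfAdjoint).2 (by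
    rw [hS.spectrum_real_eq_range_eigenvalues]
    rintro _ ⟨i, rfl⟩
    exact hb i)
  rwa [Algebra.algebraMap_eq_smul_one] at this

theorem isClosed_setOf_posSemidef {n : Type*} [Fintype n] :
    IsClosed {S : Matrix n n ℝ | S.PosSemidef} := by
  simp_rw [Matrix.posSemidef_iff_dotProduct_mulVec, Matrix.IsHermitian, Set.ofPred_and, Set.ofPred_forall]
  refine IsClosed.inter (isClosed_eq (by fun_prop) continuous_id) (isClosed_iInter fun x => ?_)
  exact isClosed_le continuous_const (by fun_prop)

theorem posSemidef_of_sub_smul_one {n : Type*} [Fintype n] [DecidableEq n] {S : Matrix n n ℝ}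
    {a : ℝ} (ha : 0 ≤ a) (hS : (S - a • 1).PosSemidef) : S.PosSemidef := by
  have h1 : (a • (1 : Matrix n n ℝ)).PosSemidef := Matrix.PosSemidef.one.smul ha
  simpa using hS.add h1

theorem dotProduct_mulVec_pos_of_sub_smul_one {n : Type*} [Fintype n] [DecidableEq n]
    {S : Matrix n n ℝ} {a : ℝ} (ha : 0 < a) (hS : (S - a • 1).PosSemidef) {x : n → ℝ}
    (hx : x ≠ 0) : 0 < x ⬝ᵥ (S *ᵥ x) := by
  have h := hS.dotProduct_mulVec_nonneg x
  rw [Matrix.sub_mulVec, Matrix.smul_mulVec, Matrix.one_mulVec, dotProduct_sub, dotProduct_smul,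
    star_trivial, smul_eq_mul] at h
  have hpos : 0 < x ⬝ᵥ x := by
    refine lt_of_le_of_ne (Finset.sum_nonneg fun i _ => mul_self_nonneg _) fun h => hx ?_
    exact dotProduct_self_eq_zero.1 h.symm
  nlinarith [mul_pos ha hpos]

/-- Row `i` of the symmetric square root has squared length `S i i ≤ b`. This confines the roots to
a compact box. -/
theorem abs_sqrt_apply_le {n : Type*} [Fintype n] [DecidableEq n] {S : Matrix n n ℝ} {b : ℝ}
    (hS : S.PosSemidef) (hSb : (b • 1 - S).PosSemidef) (i j : n) : |CFC.sqrt S i j| ≤ √b := by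
  have hR : (CFC.sqrt S)ᵀ = CFC.sqrt S :=
    (Matrix.nonneg_iff_posSemidef.1 (CFC.sqrt_nonneg S)).isHermitian
  have hRR := CFC.sqrt_mul_sqrt_self S hS.nonneg
  have h1 : S i i = ∑ k, CFC.sqrt S i k ^ 2 := by
    conv_lhs => rw [← hRR]
    rw [Matrix.mul_apply]
    refine Finset.sum_congr rfl fun k _ => ?_
    rw [sq]
    congr 1
    exact congrFun (congrFun hR i) k
  have h2 : S i i ≤ b := by
    have := hSb.diag_nonneg (i := i)
    simpa using this
  refine Real.abs_le_sqrt ?_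
  calc CFC.sqrt S i j ^ 2 ≤ ∑ k, CFC.sqrt S i k ^ 2 :=
        Finset.single_le_sum (f := fun k => CFC.sqrt S i k ^ 2) (fun k _ => sq_nonneg _)
          (Finset.mem_univ j)
    _ ≤ b := h1 ▸ h2

theorem continuous_integral_toEuclideanCLM {n : Type*} [Fintype n] [DecidableEq n]
    {f : EuclideanSpace ℝ n → ℝ} (hf : f ∈ BLOne (EuclideanSpace ℝ n))
    (ν : Measure (EuclideanSpace ℝ n)) [IsFiniteMeasure ν] :
    Continuous fun R : Matrix n n ℝ => ∫ x, f (Matrix.toEuclideanCLM (𝕜 := ℝ) R x) ∂ν := by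
  have hc : Continuous f := hf.2.continuous
  have : FirstCountableTopology (Matrix n n ℝ) :=
    inferInstanceAs (FirstCountableTopology (n → n → ℝ))
  refine continuous_of_dominated (bound := fun _ => 1) (fun R => ?_)
    (fun R => Eventually.of_forall fun x => hf.1 _) (integrable_const _)
    (Eventually.of_forall fun x => hc.comp ?_)
  · exact (hc.comp (ContinuousLinearMap.continuous _)).aestronglyMeasurable
  · have : (fun R : Matrix n n ℝ => Matrix.toEuclideanCLM (𝕜 := ℝ) R x) =
        fun R => WithLp.toLp 2 (R *ᵥ x.ofLp) := by
      rfl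
    rw [this]
    exact (PiLp.continuous_toLp 2 _).comp (by fun_prop)

/-- Covariance matrices between two positive multiples of the identity have a limit along every
ultrafilter, and the corresponding Gaussian measures converge weakly. -/
theorem exists_tendsto_multivariateGaussian {n ι : Type*} [Fintype n] [DecidableEq n]
    (U : Ultrafilter ι) {S : ι → Matrix n n ℝ} {a b : ℝ} (ha : 0 < a)
    (h : ∀ᶠ i in (U : Filter ι), (S i - a • 1).PosSemidef ∧ (b • 1 - S i).PosSemidef) :
    ∃ S₀ : Matrix n n ℝ, Tendsto S U (𝓝 S₀) ∧ (S₀ - a • 1).PosSemidef ∧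
      ∀ f ∈ BLOne (EuclideanSpace ℝ n), Tendsto (fun i => ∫ y, f y ∂multivariateGaussian 0 (S i)) U
        (𝓝 (∫ y, f y ∂multivariateGaussian 0 S₀)) := by
  have hK : IsCompact {R : Matrix n n ℝ | ∀ j k, R j k ∈ Set.Icc (-√b) (√b)} := by
    have := isCompact_univ_pi fun _ : n => isCompact_univ_pi fun _ : n =>
      isCompact_Icc (a := -√b) (b := √b)
    convert! this using 1
    ext R
    exact ⟨fun h j _ k _ => h j k, fun h j k => h j trivial k trivial⟩
  -- The limit is taken at the level of square roots: the Gaussian law is the image of the standard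
  -- one under the root, so weak convergence follows by dominated convergence, and continuity of the
  -- square root map is never needed.
  obtain ⟨R₀, -, hR₀⟩ := hK.ultrafilter_le_nhds (U.map fun i => CFC.sqrt (S i))
    (by
      rw [le_principal_iff, Ultrafilter.mem_coe, Ultrafilter.mem_map]
      filter_upwards [h] with i hi
      exact fun j k => abs_le.1
        (abs_sqrt_apply_le (posSemidef_of_sub_smul_one ha.le hi.1) hi.2 j k))
  have hR : Tendsto (fun i => CFC.sqrt (S i)) U (𝓝 R₀) := hR₀
  have hS : Tendsto S U (𝓝 (R₀ * R₀)) := by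
    refine (hR.mul hR).congr' ?_
    filter_upwards [h] with i hi
    exact CFC.sqrt_mul_sqrt_self _ (posSemidef_of_sub_smul_one ha.le hi.1).nonneg
  have hR₀' : Matrix.PosSemidef R₀ :=
    isClosed_setOf_posSemidef.mem_of_tendsto hR
      (Eventually.of_forall fun i => Matrix.nonneg_iff_posSemidef.1 (CFC.sqrt_nonneg _))
  refine ⟨R₀ * R₀, hS, ?_, fun f hf => ?_⟩
  · exact isClosed_setOf_posSemidef.mem_of_tendsto (hS.sub_const _) (h.mono fun i hi => hi.1)
  · have key : ∀ T : Matrix n n ℝ, ∫ y, f y ∂multivariateGaussian 0 T =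
        ∫ x, f (Matrix.toEuclideanCLM (𝕜 := ℝ) (CFC.sqrt T) x)
          ∂stdGaussian (EuclideanSpace ℝ n) := by
      intro T
      rw [multivariateGaussian, integral_map (by fun_prop) hf.2.continuous.aestronglyMeasurable]
      simp
    simp_rw [key]
    rw [CFC.sqrt_unique rfl hR₀'.nonneg]
    exact ((continuous_integral_toEuclideanCLM hf _).tendsto _).comp hR

variable {d : ℕ} {S : Matrix (Fin d) (Fin d) ℝ} {l : Fin d → ℝ}

theorem multivariateGaussian_hyperplane (hS : S.PosSemidef) {a : Fin d → ℝ}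
    (ha : 0 < a ⬝ᵥ (S *ᵥ a)) (c : ℝ) :
    multivariateGaussian 0 S {y | a ⬝ᵥ y.ofLp = c} = 0 := by
  set L : StrongDual ℝ (EuclideanSpace ℝ (Fin d)) := innerSL ℝ (WithLp.toLp 2 a) with hL
  have hLy : ∀ y, L y = a ⬝ᵥ y.ofLp := fun y => by
    simp [hL, PiLp.inner_apply, dotProduct, mul_comm]
  have hset : {y : EuclideanSpace ℝ (Fin d) | a ⬝ᵥ y.ofLp = c} = L ⁻¹' {c} := by
    ext y; simp [hLy]
  have hvar : Var[L; multivariateGaussian 0 S] = a ⬝ᵥ (S *ᵥ a) := by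
    have := covarianceBilin_multivariateGaussian (μ := 0) hS (WithLp.toLp 2 a) (WithLp.toLp 2 a)
    rw [← this, covarianceBilin_self IsGaussian.memLp_two_id]
    rfl
  rw [hset, ← Measure.map_apply L.continuous.measurable (measurableSet_singleton c),
    IsGaussian.map_eq_gaussianReal, hvar]
  have := nullSingletonClass_gaussianReal (μ := ∫ x, L x ∂multivariateGaussian 0 S)
    (v := (a ⬝ᵥ (S *ᵥ a)).toNNReal) (by simpa using ha)
  exact measure_singleton _

/-- Replacing the linear combination `l' y` of a centred Gaussian vector by an independent copy,
while keeping the residual, does not change its law. -/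
theorem map_prod_gaussianReal_eq_multivariateGaussian (hS : S.PosSemidef)
    (hv : 0 < combVariance l S) :
    ((multivariateGaussian 0 S).prod (gaussianReal 0 (combVariance l S).toNNReal)).map
      (fun p => p.1 + (p.2 - l ⬝ᵥ p.1.ofLp) • WithLp.toLp 2 (regCoef l S)) =
        multivariateGaussian 0 S := by
  have hm : Measurable fun p : EuclideanSpace ℝ (Fin d) × ℝ =>
      p.1 + (p.2 - l ⬝ᵥ p.1.ofLp) • WithLp.toLp 2 (regCoef l S) := by
    refine Continuous.measurable ?_
    fun_prop
  have := Measure.isProbabilityMeasure_map (μ := (multivariateGaussian 0 S).prod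
    (gaussianReal 0 (combVariance l S).toNNReal)) hm.aemeasurable
  refine Measure.ext_of_charFun ?_
  ext t
  set g : ℝ := regCoef l S ⬝ᵥ t.ofLp with hg
  -- With `g = γ' t`, pairing the recombined vector with `t` gives `⟨y, u⟩ + s g`, so the
  -- characteristic function factors over the product measure.
  set u : EuclideanSpace ℝ (Fin d) := t - g • WithLp.toLp 2 l with hu
  have hinner : ∀ y z : EuclideanSpace ℝ (Fin d), inner ℝ y z = y.ofLp ⬝ᵥ z.ofLp := fun y z => by
    simp [PiLp.inner_apply, dotProduct, mul_comm]
  have hsplit : ∀ p : EuclideanSpace ℝ (Fin d) × ℝ,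
      Complex.exp ((inner ℝ (p.1 + (p.2 - l ⬝ᵥ p.1.ofLp) • WithLp.toLp 2 (regCoef l S)) t : ℝ) *
        Complex.I) = Complex.exp ((inner ℝ p.1 u : ℝ) * Complex.I) *
          Complex.exp ((inner ℝ p.2 g : ℝ) * Complex.I) := by
    intro p
    rw [← Complex.exp_add, ← add_mul, ← Complex.ofReal_add]
    congr 3
    rw [hinner, hinner, hu]
    simp only [WithLp.ofLp_add, WithLp.ofLp_smul, WithLp.ofLp_sub, add_dotProduct,
      smul_dotProduct, dotProduct_sub, dotProduct_smul, smul_eq_mul, ← hg, RCLike.inner_apply,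
      conj_trivial]
    rw [dotProduct_comm l]
    ring
  rw [charFun_apply, integral_map hm.aemeasurable (by fun_prop)]
  simp_rw [hsplit]
  rw [integral_prod_mul (f := fun y : EuclideanSpace ℝ (Fin d) =>
    Complex.exp ((inner ℝ y u : ℝ) * Complex.I)) (g := fun s : ℝ =>
    Complex.exp ((inner ℝ s g : ℝ) * Complex.I)), ← charFun_apply, ← charFun_apply,
    charFun_multivariateGaussian hS, charFun_multivariateGaussian hS, charFun_gaussianReal,
    ← Complex.exp_add]
  congr 1
  have hSl : S *ᵥ l = combVariance l S • regCoef l S := by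
    rw [regCoef, smul_smul, mul_inv_cancel₀ hv.ne', one_smul]
  have h1 : t.ofLp ⬝ᵥ (S *ᵥ l) = combVariance l S * g := by
    rw [hSl, dotProduct_smul, dotProduct_comm, smul_eq_mul]
  have h2 : l ⬝ᵥ (S *ᵥ t.ofLp) = combVariance l S * g := by
    rw [← h1, Matrix.dotProduct_mulVec, ← Matrix.mulVec_transpose, dotProduct_comm]
    congr 2
    exact hS.isHermitian
  -- The variance splits without a cross term because `S l = v γ`; this is the independence of the
  -- residual and `l' y`.
  have hq : u.ofLp ⬝ᵥ (S *ᵥ u.ofLp) + combVariance l S * g ^ 2 = t.ofLp ⬝ᵥ (S *ᵥ t.ofLp) := by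
    simp only [hu, WithLp.ofLp_sub, WithLp.ofLp_smul, Matrix.mulVec_sub, Matrix.mulVec_smul,
      sub_dotProduct, dotProduct_sub, smul_dotProduct, dotProduct_smul, smul_eq_mul, h1, h2]
    rw [show l ⬝ᵥ (S *ᵥ l) = combVariance l S from rfl]
    ring
  rw [← hq]
  have hc : ((combVariance l S).toNNReal : ℝ) = combVariance l S := Real.coe_toNNReal _ hv.le
  simp [hc]
  ring

end Gaussian

/-! ### The probability integral transform -/

section IntegralTransform

variable (ρ : Measure ℝ) [IsFiniteMeasure ρ] [NullSingletonClass ρ]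

theorem continuous_measureReal_Iic : Continuous fun s => ρ.real (Set.Iic s) := by
  have h : (fun s => ρ.real (Set.Iic s)) =
      fun s => ∫ t, (Set.Iic s).indicator (fun _ => (1 : ℝ)) t ∂ρ := by
    ext s
    exact (integral_indicator_one measurableSet_Iic).symm
  rw [h, continuous_iff_continuousAt]
  intro s₀
  refine continuousAt_of_dominated (bound := fun _ => (1 : ℝ))
    (Eventually.of_forall fun s =>
      (measurable_const.indicator measurableSet_Iic).aestronglyMeasurable)
    (Eventually.of_forall fun s => Eventually.of_forall fun t => ?_) (integrable_const _) ?_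
  · change ‖(Set.Iic s).indicator (fun _ => (1 : ℝ)) t‖ ≤ 1
    simp only [Set.indicator]
    split_ifs <;> simp
  · have hne : ∀ᵐ t ∂ρ, t ≠ s₀ := Measure.ae_ne ρ s₀
    filter_upwards [hne] with t ht
    rcases lt_or_gt_of_ne ht with h | h
    · refine ContinuousAt.congr (f := fun _ => (1 : ℝ)) continuousAt_const ?_
      filter_upwards [lt_mem_nhds h] with s hs
      simp [hs.le]
    · refine ContinuousAt.congr (f := fun _ => (0 : ℝ)) continuousAt_const ?_
      filter_upwards [gt_mem_nhds h] with s hs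
      simp [hs]

/-- The probability integral transform without normalization, so that measures of mass zero are
allowed. Absence of atoms makes the distribution function continuous, which turns the two
inequalities into equality. -/
theorem measureReal_Iic_le_mul {z : ℝ} (hz : z ∈ Set.Icc (0 : ℝ) 1) :
    ρ.real {s | ρ.real (Set.Iic s) ≤ z * ρ.real Set.univ} = z * ρ.real Set.univ := by
  have hcont := continuous_measureReal_Iic ρ
  have hmono : Monotone fun s => ρ.real (Set.Iic s) := fun s t hst =>
    measureReal_mono (Set.Iic_subset_Iic.2 hst) (measure_ne_top _ _)
  have htop : Tendsto (fun s => ρ.real (Set.Iic s)) atTop (𝓝 (ρ.real Set.univ)) :=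
    (ENNReal.tendsto_toReal (measure_ne_top _ _)).comp (tendsto_measure_Iic_atTop ρ)
  have hbot : Tendsto (fun s => ρ.real (Set.Iic s)) atBot (𝓝 0) := by
    have h : Tendsto (fun s => ρ.real (Set.Ici s)) atBot (𝓝 (ρ.real Set.univ)) :=
      (ENNReal.tendsto_toReal (measure_ne_top _ _)).comp (tendsto_measure_Ici_atBot ρ)
    have h' := h.const_sub (ρ.real Set.univ)
    rw [sub_self] at h'
    refine h'.congr fun s => ?_
    rw [← measureReal_compl measurableSet_Ici, Set.compl_Ici]
    exact measureReal_congr Iio_ae_eq_Iic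
  rcases (measureReal_nonneg (μ := ρ) (s := Set.univ)).eq_or_lt with hD | hD
  · rw [← hD, mul_zero]
    exact le_antisymm ((measureReal_mono (Set.subset_univ _)).trans hD.ge) measureReal_nonneg
  rcases hz.2.eq_or_lt with rfl | hz1
  · rw [one_mul]
    congr 1
    ext s
    simpa using measureReal_mono (Set.subset_univ _)
  apply le_antisymm
  · rcases Set.eq_empty_or_nonempty {s | ρ.real (Set.Iic s) ≤ z * ρ.real Set.univ} with he | hne
    · rw [he]
      simpa using mul_nonneg hz.1 hD.le
    · have hlt : z * ρ.real Set.univ < ρ.real Set.univ := by nlinarith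
      obtain ⟨M, hM⟩ := eventually_atTop.1 (htop.eventually_const_lt hlt)
      -- For `z < 1` the sublevel set is closed and bounded above, so its supremum belongs to it and
      -- the ray up to that supremum has mass at most `z` times the total.
      have hbdd : BddAbove {s | ρ.real (Set.Iic s) ≤ z * ρ.real Set.univ} :=
        ⟨M, fun s hs => le_of_not_gt fun h => (hM s h.le).not_ge hs⟩
      have hmem := (isClosed_le hcont continuous_const).csSup_mem hne hbdd
      exact (measureReal_mono (fun s hs => le_csSup hbdd hs) (measure_ne_top _ _)).trans hmem
  · rcases hz.1.eq_or_lt with rfl | hz0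
    · simp
    have hpos : 0 < z * ρ.real Set.univ := mul_pos hz0 hD
    obtain ⟨s₀, hs₀⟩ := mem_range_of_exists_le_of_exists_ge hcont
      ((hbot.eventually_le_const hpos).exists)
      ((htop.eventually_const_le (show z * ρ.real Set.univ < ρ.real Set.univ by nlinarith)).exists)
    rw [← hs₀]
    exact measureReal_mono (fun s hs => hmono hs) (measure_ne_top _ _)

theorem measureReal_Iic_lt_mul {z : ℝ} (hz : z ∈ Set.Icc (0 : ℝ) 1) :
    ρ.real {s | ρ.real (Set.Iic s) < z * ρ.real Set.univ} = z * ρ.real Set.univ := by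
  rcases (measureReal_nonneg (μ := ρ) (s := Set.univ)).eq_or_lt with hD | hD
  · rw [← hD, mul_zero]
    exact le_antisymm ((measureReal_mono (Set.subset_univ _)).trans hD.ge) measureReal_nonneg
  apply le_antisymm
  · conv_rhs => rw [← measureReal_Iic_le_mul ρ hz]
    exact measureReal_mono (fun s hs => le_of_lt (Set.mem_ofPred_eq.mp hs)) (measure_ne_top _ _)
  · rcases hz.1.eq_or_lt with rfl | hz0
    · simp
    -- The strict sublevel set contains the weak sublevel set of every lower level `r`, whose mass
    -- is exactly `r`.
    refine le_of_forall_lt_imp_le_of_dense fun r hr => ?_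
    rcases lt_or_ge r 0 with h0 | h0
    · exact h0.le.trans measureReal_nonneg
    have hr' : r / ρ.real Set.univ < z := (div_lt_iff₀ hD).2 hr
    have hrD : r / ρ.real Set.univ * ρ.real Set.univ = r := div_mul_cancel₀ _ hD.ne'
    have := measureReal_Iic_le_mul ρ (z := r / ρ.real Set.univ)
      ⟨by positivity, hr'.le.trans hz.2⟩
    rw [hrD] at this
    conv_lhs => rw [← this]
    exact measureReal_mono (fun s hs => lt_of_le_of_lt hs hr) (measure_ne_top _ _)

end IntegralTransform

/-! ### Truncated Gaussian masses along a line -/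

/-- The set of `t` for which the point of the line `y + (t - l' y) γ` lies in `Q`. -/
def lineSet {d : ℕ} (Q : Set (EuclideanSpace ℝ (Fin d))) (l γ : Fin d → ℝ)
    (y : EuclideanSpace ℝ (Fin d)) : Set ℝ :=
  {t | y + (t - l ⬝ᵥ y.ofLp) • WithLp.toLp 2 γ ∈ Q}

/-- The unnormalized mass that the centred normal distribution with variance `v` gives to the part
of `lineSet Q l γ y` up to `l' y`. -/
def lineNumer {d : ℕ} (Q : Set (EuclideanSpace ℝ (Fin d))) (l γ : Fin d → ℝ) (v : ℝ)
    (y : EuclideanSpace ℝ (Fin d)) : ℝ :=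
  ∫ t, (Set.Iic (l ⬝ᵥ y.ofLp) ∩ lineSet Q l γ y).indicator
    (fun t => gaussianPDFReal 0 1 (t / √v)) t

/-- The unnormalized mass that the centred normal distribution with variance `v` gives to
`lineSet Q l γ y`. -/
def lineDenom {d : ℕ} (Q : Set (EuclideanSpace ℝ (Fin d))) (l γ : Fin d → ℝ) (v : ℝ)
    (y : EuclideanSpace ℝ (Fin d)) : ℝ :=
  ∫ t, (lineSet Q l γ y).indicator (fun t => gaussianPDFReal 0 1 (t / √v)) t

section Line

variable {d : ℕ} {Q : Set (EuclideanSpace ℝ (Fin d))} {l γ : Fin d → ℝ} {v : ℝ}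

theorem measurable_linePoint (l γ : Fin d → ℝ) :
    Measurable fun p : EuclideanSpace ℝ (Fin d) × ℝ =>
      p.1 + (p.2 - l ⬝ᵥ p.1.ofLp) • WithLp.toLp 2 γ := by
  refine Continuous.measurable ?_
  fun_prop

theorem measurableSet_lineSet (hQ : MeasurableSet Q) (l γ : Fin d → ℝ)
    (y : EuclideanSpace ℝ (Fin d)) : MeasurableSet (lineSet Q l γ y) :=
  ((measurable_linePoint l γ).comp measurable_prodMk_left) hQ

theorem gaussianPDFReal_div_sqrt (hv : 0 < v) (t : ℝ) :
    gaussianPDFReal 0 1 (t / √v) = √v * gaussianPDFReal 0 v.toNNReal t := by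
  have h2 : √v ^ 2 = v := Real.sq_sqrt hv.le
  have h3 : √(2 * Real.pi * v) = √(2 * Real.pi) * √v := Real.sqrt_mul (by positivity) _
  have h4 : 0 < √v := Real.sqrt_pos.2 hv
  simp only [gaussianPDFReal, sub_zero, NNReal.coe_one, mul_one, Real.coe_toNNReal _ hv.le, div_pow,
    h2, h3]
  rw [mul_inv, show √v * ((√(2 * Real.pi))⁻¹ * (√v)⁻¹ * Real.exp (-t ^ 2 / (2 * v))) =
    (√v * (√v)⁻¹) * (√(2 * Real.pi))⁻¹ * Real.exp (-t ^ 2 / (2 * v)) by ring,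
    mul_inv_cancel₀ h4.ne', one_mul]
  congr 2
  field_simp

theorem integral_indicator_gaussianPDFReal_div_sqrt (hv : 0 < v) {B : Set ℝ}
    (hB : MeasurableSet B) :
    ∫ t, B.indicator (fun t => gaussianPDFReal 0 1 (t / √v)) t =
      √v * (gaussianReal 0 v.toNNReal).real B := by
  have hv' : v.toNNReal ≠ 0 := by simpa using hv
  rw [measureReal_def, gaussianReal_apply_eq_integral 0 hv' B, ENNReal.toReal_ofReal
    (integral_nonneg fun t => gaussianPDFReal_nonneg _ _ _), integral_indicator hB,
    ← integral_const_mul]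
  simp_rw [gaussianPDFReal_div_sqrt hv]

theorem lineDenom_eq (hQ : MeasurableSet Q) (hv : 0 < v) (y : EuclideanSpace ℝ (Fin d)) :
    lineDenom Q l γ v y =
      √v * ((gaussianReal 0 v.toNNReal).restrict (lineSet Q l γ y)).real Set.univ := by
  rw [lineDenom, integral_indicator_gaussianPDFReal_div_sqrt hv (measurableSet_lineSet hQ l γ y),
    measureReal_restrict_apply MeasurableSet.univ, Set.univ_inter]

theorem lineNumer_eq (hQ : MeasurableSet Q) (hv : 0 < v) (y : EuclideanSpace ℝ (Fin d)) :
    lineNumer Q l γ v y = √v * ((gaussianReal 0 v.toNNReal).restrict (lineSet Q l γ y)).real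
      (Set.Iic (l ⬝ᵥ y.ofLp)) := by
  rw [lineNumer, integral_indicator_gaussianPDFReal_div_sqrt hv
    (measurableSet_Iic.inter (measurableSet_lineSet hQ l γ y)),
    measureReal_restrict_apply measurableSet_Iic]

theorem measurable_lineDenom (hQ : MeasurableSet Q) : Measurable (lineDenom Q l γ v) := by
  have hB : MeasurableSet {p : EuclideanSpace ℝ (Fin d) × ℝ | p.2 ∈ lineSet Q l γ p.1} :=
    measurable_linePoint l γ hQ
  have hf : Measurable fun p : EuclideanSpace ℝ (Fin d) × ℝ =>
      gaussianPDFReal 0 1 (p.2 / √v) :=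
    (measurable_gaussianPDFReal 0 1).comp (measurable_snd.div_const _)
  have := (hf.indicator hB).stronglyMeasurable.integral_prod_right' (ν := volume)
  exact this.measurable

theorem measurable_lineNumer (hQ : MeasurableSet Q) : Measurable (lineNumer Q l γ v) := by
  have hB : MeasurableSet {p : EuclideanSpace ℝ (Fin d) × ℝ |
      p.2 ∈ Set.Iic (l ⬝ᵥ p.1.ofLp) ∩ lineSet Q l γ p.1} := by
    refine MeasurableSet.inter ?_ (measurable_linePoint l γ hQ)
    exact (isClosed_le continuous_snd (by fun_prop)).measurableSet
  have hf : Measurable fun p : EuclideanSpace ℝ (Fin d) × ℝ =>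
      gaussianPDFReal 0 1 (p.2 / √v) :=
    (measurable_gaussianPDFReal 0 1).comp (measurable_snd.div_const _)
  have := (hf.indicator hB).stronglyMeasurable.integral_prod_right' (ν := volume)
  exact this.measurable

theorem dotProduct_linePoint (hγ : l ⬝ᵥ γ = 1) (y : EuclideanSpace ℝ (Fin d)) (s : ℝ) :
    l ⬝ᵥ (y + (s - l ⬝ᵥ y.ofLp) • WithLp.toLp 2 γ).ofLp = s := by
  simp only [WithLp.ofLp_add, WithLp.ofLp_smul, dotProduct_add, dotProduct_smul, hγ, smul_eq_mul]
  ring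

/-- Moving `y` along `γ` does not change the line, and `l' γ = 1` makes `l' y` its coordinate. Hence
on a fixed line the truncation set is constant while `l' y` varies. -/
theorem lineSet_linePoint (hγ : l ⬝ᵥ γ = 1) (y : EuclideanSpace ℝ (Fin d)) (s : ℝ) :
    lineSet Q l γ (y + (s - l ⬝ᵥ y.ofLp) • WithLp.toLp 2 γ) = lineSet Q l γ y := by
  ext t
  simp only [lineSet, Set.mem_ofPred_eq, dotProduct_linePoint hγ]
  rw [add_assoc, ← add_smul]
  ring_nf

theorem dotProduct_regCoef {S : Matrix (Fin d) (Fin d) ℝ} (hv : combVariance l S ≠ 0) :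
    l ⬝ᵥ regCoef l S = 1 := by
  rw [regCoef, dotProduct_smul, smul_eq_mul]
  exact inv_mul_cancel₀ hv

variable {S : Matrix (Fin d) (Fin d) ℝ}

/-- Resampling `l' y` leaves the Gaussian law unchanged, so Fubini writes each probability as an
average of its masses on lines; proportionality on every line then integrates. -/
theorem multivariateGaussian_eq_mul_of_line (hS : S.PosSemidef) (hv : 0 < combVariance l S)
    (hQ : MeasurableSet Q) {M : Set (EuclideanSpace ℝ (Fin d))} (hM : MeasurableSet M) {z : ℝ}
    (hz : 0 ≤ z)
    (h : ∀ y, (gaussianReal 0 (combVariance l S).toNNReal).real (lineSet M l (regCoef l S) y) =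
      z * (gaussianReal 0 (combVariance l S).toNNReal).real (lineSet Q l (regCoef l S) y)) :
    (multivariateGaussian 0 S).real M = z * (multivariateGaussian 0 S).real Q := by
  have key : ∀ B : Set (EuclideanSpace ℝ (Fin d)), MeasurableSet B →
      multivariateGaussian 0 S B = ∫⁻ y, gaussianReal 0 (combVariance l S).toNNReal
        (lineSet B l (regCoef l S) y) ∂multivariateGaussian 0 S := by
    intro B hB
    conv_lhs => rw [← map_prod_gaussianReal_eq_multivariateGaussian hS hv]
    rw [Measure.map_apply (measurable_linePoint _ _) hB,
      Measure.prod_apply (measurable_linePoint _ _ hB)]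
    rfl
  have h' : ∀ y, gaussianReal 0 (combVariance l S).toNNReal (lineSet M l (regCoef l S) y) =
      ENNReal.ofReal z *
        gaussianReal 0 (combVariance l S).toNNReal (lineSet Q l (regCoef l S) y) := by
    intro y
    rw [← ofReal_measureReal, h, ENNReal.ofReal_mul hz, ofReal_measureReal]
  rw [measureReal_def, key M hM]
  simp_rw [h']
  rw [lintegral_const_mul' _ _ ENNReal.ofReal_ne_top, ← key Q hQ, ENNReal.toReal_mul,
    ENNReal.toReal_ofReal hz, measureReal_def]

theorem multivariateGaussian_lineNumer_le (hS : S.PosSemidef) (hv : 0 < combVariance l S)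
    (hQ : MeasurableSet Q) {z : ℝ} (hz : z ∈ Set.Icc (0 : ℝ) 1) :
    (multivariateGaussian 0 S).real {y | y ∈ Q ∧
      lineNumer Q l (regCoef l S) (combVariance l S) y ≤
        z * lineDenom Q l (regCoef l S) (combVariance l S) y} =
      z * (multivariateGaussian 0 S).real Q := by
  have hγ := dotProduct_regCoef hv.ne'
  refine multivariateGaussian_eq_mul_of_line hS hv hQ (hQ.inter (measurableSet_le
    (measurable_lineNumer hQ) ((measurable_lineDenom hQ).const_mul z))) hz.1 fun y => ?_
  have hT := measurableSet_lineSet hQ l (regCoef l S) y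
  have := nullSingletonClass_gaussianReal (μ := 0) (v := (combVariance l S).toNNReal)
    (by simpa using hv)
  have hp := measureReal_Iic_le_mul ((gaussianReal 0 (combVariance l S).toNNReal).restrict
    (lineSet Q l (regCoef l S) y)) hz
  rw [measureReal_restrict_apply' hT, measureReal_restrict_apply MeasurableSet.univ,
    Set.univ_inter] at hp
  rw [← hp]
  congr 1
  ext s
  have hsq : 0 < √(combVariance l S) := Real.sqrt_pos.2 hv
  simp only [lineSet, Set.mem_ofPred_eq, Set.mem_inter_iff]
  rw [lineNumer_eq hQ hv, lineDenom_eq hQ hv, lineSet_linePoint hγ, dotProduct_linePoint hγ,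
    measureReal_restrict_apply MeasurableSet.univ, Set.univ_inter, mul_left_comm,
    mul_le_mul_iff_right₀ hsq, and_comm]
  rfl

theorem multivariateGaussian_lineNumer_lt (hS : S.PosSemidef) (hv : 0 < combVariance l S)
    (hQ : MeasurableSet Q) {z : ℝ} (hz : z ∈ Set.Icc (0 : ℝ) 1) :
    (multivariateGaussian 0 S).real {y | y ∈ Q ∧
      lineNumer Q l (regCoef l S) (combVariance l S) y <
        z * lineDenom Q l (regCoef l S) (combVariance l S) y} =
      z * (multivariateGaussian 0 S).real Q := by
  have hγ := dotProduct_regCoef hv.ne'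
  refine multivariateGaussian_eq_mul_of_line hS hv hQ (hQ.inter (measurableSet_lt
    (measurable_lineNumer hQ) ((measurable_lineDenom hQ).const_mul z))) hz.1 fun y => ?_
  have hT := measurableSet_lineSet hQ l (regCoef l S) y
  have := nullSingletonClass_gaussianReal (μ := 0) (v := (combVariance l S).toNNReal)
    (by simpa using hv)
  have hp := measureReal_Iic_lt_mul ((gaussianReal 0 (combVariance l S).toNNReal).restrict
    (lineSet Q l (regCoef l S) y)) hz
  rw [measureReal_restrict_apply' hT, measureReal_restrict_apply MeasurableSet.univ,
    Set.univ_inter] at hp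
  rw [← hp]
  congr 1
  ext s
  have hsq : 0 < √(combVariance l S) := Real.sqrt_pos.2 hv
  simp only [lineSet, Set.mem_ofPred_eq, Set.mem_inter_iff]
  rw [lineNumer_eq hQ hv, lineDenom_eq hQ hv, lineSet_linePoint hγ, dotProduct_linePoint hγ,
    measureReal_restrict_apply MeasurableSet.univ, Set.univ_inter, mul_left_comm,
    mul_lt_mul_iff_right₀ hsq, and_comm]
  rfl

theorem lineNumer_nonneg (v : ℝ) (y : EuclideanSpace ℝ (Fin d)) : 0 ≤ lineNumer Q l γ v y :=
  integral_nonneg fun _ => Set.indicator_nonneg (fun _ _ => gaussianPDFReal_nonneg _ _ _) _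

theorem lineDenom_nonneg (v : ℝ) (y : EuclideanSpace ℝ (Fin d)) : 0 ≤ lineDenom Q l γ v y :=
  integral_nonneg fun _ => Set.indicator_nonneg (fun _ _ => gaussianPDFReal_nonneg _ _ _) _

theorem lineNumer_le_lineDenom (hQ : MeasurableSet Q) (hv : 0 < v)
    (y : EuclideanSpace ℝ (Fin d)) : lineNumer Q l γ v y ≤ lineDenom Q l γ v y := by
  rw [lineNumer_eq hQ hv, lineDenom_eq hQ hv]
  exact mul_le_mul_of_nonneg_left (measureReal_mono (Set.subset_univ _)) (Real.sqrt_nonneg _)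

/-- The weak and strict sublevel events have the same mass `z P(Q)`, so ties are null. The levels
`0` and `1` are included and rule out degenerate truncated laws. -/
theorem ae_lineNumer_ne (hS : S.PosSemidef) (hv : 0 < combVariance l S)
    (hQ : MeasurableSet Q) {z : ℝ} (hz : z ∈ Set.Icc (0 : ℝ) 1) :
    ∀ᵐ y ∂multivariateGaussian 0 S, y ∈ Q → lineNumer Q l (regCoef l S) (combVariance l S) y ≠
      z * lineDenom Q l (regCoef l S) (combVariance l S) y := by
  have hlt : MeasurableSet {y | y ∈ Q ∧ lineNumer Q l (regCoef l S) (combVariance l S) y <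
      z * lineDenom Q l (regCoef l S) (combVariance l S) y} :=
    hQ.inter (measurableSet_lt (measurable_lineNumer hQ) ((measurable_lineDenom hQ).const_mul z))
  have h := measureReal_sdiff (μ := multivariateGaussian 0 S)
    (s₁ := {y | y ∈ Q ∧ lineNumer Q l (regCoef l S) (combVariance l S) y ≤
      z * lineDenom Q l (regCoef l S) (combVariance l S) y}) (fun y hy => ⟨hy.1, hy.2.le⟩) hlt
  rw [multivariateGaussian_lineNumer_le hS hv hQ hz, multivariateGaussian_lineNumer_lt hS hv hQ hz,
    sub_self, measureReal_eq_zero_iff] at h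
  rw [ae_iff]
  refine measure_mono_null (fun y hy => ?_) h
  simp only [Set.mem_ofPred_eq, Classical.not_imp, not_not] at hy
  exact ⟨⟨hy.1, hy.2.le⟩, fun h => h.2.ne hy.2⟩

theorem multivariateGaussian_lineNumer_mem_Ioo (hS : S.PosSemidef) (hv : 0 < combVariance l S)
    (hQ : MeasurableSet Q) {a b : ℝ} (ha : 0 ≤ a) (hab : a ≤ b) (hb : b ≤ 1) :
    (multivariateGaussian 0 S).real {y | y ∈ Q ∧
      a * lineDenom Q l (regCoef l S) (combVariance l S) y <
        lineNumer Q l (regCoef l S) (combVariance l S) y ∧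
      lineNumer Q l (regCoef l S) (combVariance l S) y <
        b * lineDenom Q l (regCoef l S) (combVariance l S) y} =
      (b - a) * (multivariateGaussian 0 S).real Q := by
  have hle : MeasurableSet {y | y ∈ Q ∧ lineNumer Q l (regCoef l S) (combVariance l S) y ≤
      a * lineDenom Q l (regCoef l S) (combVariance l S) y} :=
    hQ.inter (measurableSet_le (measurable_lineNumer hQ) ((measurable_lineDenom hQ).const_mul a))
  rw [sub_mul, ← multivariateGaussian_lineNumer_lt hS hv hQ ⟨ha.trans hab, hb⟩,
    ← multivariateGaussian_lineNumer_le hS hv hQ ⟨ha, hab.trans hb⟩, eq_sub_iff_add_eq,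
    ← measureReal_union _ hle]
  · refine measureReal_congr ?_
    -- Discarding ties at level `b` covers the case in which `N ≤ a D` only yields `N ≤ b D`, for
    -- instance when `a = b`.
    filter_upwards [ae_lineNumer_ne hS hv hQ (z := b) ⟨ha.trans hab, hb⟩] with y hy
    refine propext ⟨?_, fun h => ?_⟩
    · rintro (h | h)
      · exact ⟨h.1, h.2.2⟩
      · refine ⟨h.1, lt_of_le_of_ne (h.2.trans ?_) (hy h.1)⟩
        exact mul_le_mul_of_nonneg_right hab (lineDenom_nonneg _ _)
    · rcases lt_or_ge (a * lineDenom Q l (regCoef l S) (combVariance l S) y)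
        (lineNumer Q l (regCoef l S) (combVariance l S) y) with h' | h'
      · exact Or.inl ⟨h.1, h', h.2⟩
      · exact Or.inr ⟨h.1, h'⟩
  · rw [Set.disjoint_left]
    exact fun y hy hy' => hy.2.1.not_ge hy'.2

end Line

/-! ### Polyhedra with extended real cutoffs -/

/-- The union over `k` of the polyhedra `{b : A k b ≤ C k}`, where the cutoffs may be infinite. -/
def extPolyhedralUnion {d K : ℕ} {m : Fin K → ℕ} (A : ∀ k, Matrix (Fin (m k)) (Fin d) ℝ)
    (C : ∀ k, Fin (m k) → EReal) : Set (EuclideanSpace ℝ (Fin d)) :=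
  {b | ∃ k, ∀ j, (((A k *ᵥ b.ofLp) j : ℝ) : EReal) ≤ C k j}

section ExtPolyhedral

variable {d K : ℕ} {m : Fin K → ℕ} {A : ∀ k, Matrix (Fin (m k)) (Fin d) ℝ}

theorem measurableSet_extPolyhedralUnion (C : ∀ k, Fin (m k) → EReal) :
    MeasurableSet (extPolyhedralUnion A C) := by
  simp only [extPolyhedralUnion, Set.ofPred_exists, Set.ofPred_forall]
  refine MeasurableSet.iUnion fun k => MeasurableSet.iInter fun j => ?_
  refine (isClosed_le (continuous_coe_real_ereal.comp ?_) continuous_const).measurableSet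
  fun_prop

/-- Off the boundary every constraint is strictly satisfied or strictly violated in `EReal`, and
both persist under small perturbations, even when the limiting cutoff is infinite. -/
theorem eventually_mem_extPolyhedralUnion_iff {Θ : Type*} [TopologicalSpace Θ] {p₀ : Θ}
    {g : Θ → EuclideanSpace ℝ (Fin d)} {C : Θ → ∀ k, Fin (m k) → EReal}
    (hg : ContinuousAt g p₀) (hC : ContinuousAt C p₀)
    (hne : ∀ k j, (((A k *ᵥ (g p₀).ofLp) j : ℝ) : EReal) ≠ C p₀ k j) :
    ∀ᶠ p in 𝓝 p₀, (g p ∈ extPolyhedralUnion A (C p) ↔ g p₀ ∈ extPolyhedralUnion A (C p₀)) := by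
  have h : ∀ k j, ∀ᶠ p in 𝓝 p₀, ((((A k *ᵥ (g p).ofLp) j : ℝ) : EReal) ≤ C p k j ↔
      (((A k *ᵥ (g p₀).ofLp) j : ℝ) : EReal) ≤ C p₀ k j) := by
    intro k j
    have h1 : ContinuousAt (fun p => (((A k *ᵥ (g p).ofLp) j : ℝ) : EReal)) p₀ := by
      have hc : Continuous fun b : EuclideanSpace ℝ (Fin d) =>
          (((A k *ᵥ b.ofLp) j : ℝ) : EReal) := continuous_coe_real_ereal.comp (by fun_prop)
      exact hc.continuousAt.comp hg
    have h2 : ContinuousAt (fun p => C p k j) p₀ :=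
      (continuous_apply j).continuousAt.comp ((continuous_apply k).continuousAt.comp hC)
    rcases lt_or_gt_of_ne (hne k j) with hlt | hgt
    · filter_upwards [Tendsto.eventually_lt h1 h2 hlt] with p hp
      exact ⟨fun _ => hlt.le, fun _ => hp.le⟩
    · filter_upwards [Tendsto.eventually_lt h2 h1 hgt] with p hp
      exact ⟨fun h => absurd h hp.not_ge, fun h => absurd h hgt.not_ge⟩
  filter_upwards [eventually_all.2 fun k => eventually_all.2 fun j => h k j] with p hp
  exact exists_congr fun k => forall_congr' fun j => hp k j

/-- A line transversal to a bounding hyperplane meets it at most once; a parallel line never meets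
it, since `y` itself is off the hyperplane. -/
theorem ae_linePoint_ne {C : ∀ k, Fin (m k) → EReal} (l γ : Fin d → ℝ)
    {y : EuclideanSpace ℝ (Fin d)} (hne : ∀ k j, (((A k *ᵥ y.ofLp) j : ℝ) : EReal) ≠ C k j) :
    ∀ᵐ t : ℝ, ∀ k j, (((A k *ᵥ (y + (t - l ⬝ᵥ y.ofLp) • WithLp.toLp 2 γ).ofLp) j : ℝ) : EReal) ≠
      C k j := by
  refine ae_all_iff.2 fun k => ae_all_iff.2 fun j => ?_
  have hlin : ∀ t : ℝ, (A k *ᵥ (y + (t - l ⬝ᵥ y.ofLp) • WithLp.toLp 2 γ).ofLp) j =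
      (A k *ᵥ y.ofLp) j + (t - l ⬝ᵥ y.ofLp) * (A k *ᵥ γ) j := fun t => by
    simp [Matrix.mulVec_add, Matrix.mulVec_smul]
  rw [ae_iff]
  refine Set.Subsingleton.measure_zero (fun s hs t ht => ?_) _
  simp only [Set.mem_ofPred_eq, not_not, hlin] at hs ht
  have hst := hs.trans ht.symm
  rw [EReal.coe_eq_coe_iff] at hst
  by_cases hb : (A k *ᵥ γ) j = 0
  · rw [hb, mul_zero, add_zero] at hs
    exact absurd hs (hne k j)
  · have := mul_right_cancel₀ hb (add_left_cancel hst)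
    linarith

theorem continuousAt_integral_indicator_gaussianPDFReal {Θ : Type*} [TopologicalSpace Θ]
    [FirstCountableTopology Θ] {p₀ : Θ} {B : Θ → Set ℝ} {v : Θ → ℝ}
    (hB : ∀ p, MeasurableSet (B p)) (hBev : ∀ᵐ t : ℝ, ∀ᶠ p in 𝓝 p₀, (t ∈ B p ↔ t ∈ B p₀))
    (hv : ContinuousAt v p₀) (hv₀ : 0 < v p₀) :
    ContinuousAt (fun p => ∫ t, (B p).indicator (fun t => gaussianPDFReal 0 1 (t / √(v p))) t)
      p₀ := by
  have hφ : Continuous (gaussianPDFReal 0 1) := by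
    unfold gaussianPDFReal
    fun_prop
  -- Near `p₀` the variance stays below `2 v p₀`, and `φ(t / √v)` increases with `v`, so the
  -- Gaussian profile of variance `2 v p₀` dominates.
  refine continuousAt_of_dominated
    (bound := fun t => √(2 * v p₀) * gaussianPDFReal 0 (2 * v p₀).toNNReal t) ?_ ?_ ?_ ?_
  · refine Eventually.of_forall fun p => ?_
    exact ((hφ.measurable.comp (measurable_id.div_const _)).indicator (hB p)).aestronglyMeasurable
  · filter_upwards [hv.eventually_const_lt hv₀,
      hv.eventually_lt_const (show v p₀ < 2 * v p₀ by linarith)] with p hp1 hp2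
    refine Eventually.of_forall fun t => ?_
    rw [← gaussianPDFReal_div_sqrt (by positivity : 0 < 2 * v p₀)]
    refine (norm_indicator_le_norm_self _ _).trans ?_
    rw [Real.norm_eq_abs, abs_of_nonneg (gaussianPDFReal_nonneg _ _ _)]
    simp only [gaussianPDFReal, sub_zero, NNReal.coe_one, mul_one, div_pow, Real.sq_sqrt hp1.le,
      Real.sq_sqrt (by positivity : 0 ≤ 2 * v p₀)]
    gcongr
  · exact (integrable_gaussianPDFReal _ _).const_mul _
  · filter_upwards [hBev] with t ht
    have hc : ContinuousAt (fun p => gaussianPDFReal 0 1 (t / √(v p))) p₀ := by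
      refine hφ.continuousAt.comp (ContinuousAt.div continuousAt_const hv.sqrt ?_)
      exact (Real.sqrt_pos.2 hv₀).ne'
    by_cases ht₀ : t ∈ B p₀
    · refine hc.congr ?_
      filter_upwards [ht] with p hp
      simp [hp.2 ht₀]
    · refine ContinuousAt.congr (f := fun _ => (0 : ℝ)) continuousAt_const ?_
      filter_upwards [ht] with p hp
      simp [mt hp.1 ht₀]

/-- The parameters besides the normalized estimator: a direction, a variance, and cutoffs. -/
abbrev LineParam (d : ℕ) {K : ℕ} (m : Fin K → ℕ) : Type :=
  (Fin d → ℝ) × ℝ × (∀ k, Fin (m k) → EReal)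

theorem ae_eventually_mem_lineSet_iff (l : Fin d → ℝ) {θ : LineParam d m}
    {y : EuclideanSpace ℝ (Fin d)}
    (hne : ∀ k j, (((A k *ᵥ y.ofLp) j : ℝ) : EReal) ≠ θ.2.2 k j) :
    ∀ᵐ t : ℝ, ∀ᶠ p : EuclideanSpace ℝ (Fin d) × LineParam d m in 𝓝 (y, θ),
      (t ∈ lineSet (extPolyhedralUnion A p.2.2.2) l p.2.1 p.1 ↔
        t ∈ lineSet (extPolyhedralUnion A θ.2.2) l θ.1 y) := by
  filter_upwards [ae_linePoint_ne l θ.1 hne] with t ht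
  refine eventually_mem_extPolyhedralUnion_iff (p₀ := (y, θ))
    (g := fun p : EuclideanSpace ℝ (Fin d) × LineParam d m =>
      p.1 + (t - l ⬝ᵥ p.1.ofLp) • WithLp.toLp 2 p.2.1) (C := fun p => p.2.2.2) ?_ ?_ ht
  · refine Continuous.continuousAt ?_
    fun_prop
  · refine Continuous.continuousAt ?_
    fun_prop

theorem continuousAt_lineDenom (l : Fin d → ℝ) {θ : LineParam d m} (hv : 0 < θ.2.1)
    {y : EuclideanSpace ℝ (Fin d)}
    (hne : ∀ k j, (((A k *ᵥ y.ofLp) j : ℝ) : EReal) ≠ θ.2.2 k j) :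
    ContinuousAt (fun p : EuclideanSpace ℝ (Fin d) × LineParam d m =>
      lineDenom (extPolyhedralUnion A p.2.2.2) l p.2.1 p.2.2.1 p.1) (y, θ) := by
  have hvc : ContinuousAt (fun p : EuclideanSpace ℝ (Fin d) × LineParam d m => p.2.2.1) (y, θ) :=
    Continuous.continuousAt (by fun_prop)
  exact continuousAt_integral_indicator_gaussianPDFReal (p₀ := (y, θ))
    (B := fun p => lineSet (extPolyhedralUnion A p.2.2.2) l p.2.1 p.1)
    (fun p => measurableSet_lineSet (measurableSet_extPolyhedralUnion _) _ _ _)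
    (ae_eventually_mem_lineSet_iff l hne) hvc hv

theorem continuousAt_lineNumer (l : Fin d → ℝ) {θ : LineParam d m} (hv : 0 < θ.2.1)
    {y : EuclideanSpace ℝ (Fin d)}
    (hne : ∀ k j, (((A k *ᵥ y.ofLp) j : ℝ) : EReal) ≠ θ.2.2 k j) :
    ContinuousAt (fun p : EuclideanSpace ℝ (Fin d) × LineParam d m =>
      lineNumer (extPolyhedralUnion A p.2.2.2) l p.2.1 p.2.2.1 p.1) (y, θ) := by
  have hvc : ContinuousAt (fun p : EuclideanSpace ℝ (Fin d) × LineParam d m => p.2.2.1) (y, θ) :=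
    Continuous.continuousAt (by fun_prop)
  have hB : ∀ᵐ t : ℝ, ∀ᶠ p : EuclideanSpace ℝ (Fin d) × LineParam d m in 𝓝 (y, θ),
      (t ∈ Set.Iic (l ⬝ᵥ p.1.ofLp) ∩ lineSet (extPolyhedralUnion A p.2.2.2) l p.2.1 p.1 ↔
        t ∈ Set.Iic (l ⬝ᵥ y.ofLp) ∩ lineSet (extPolyhedralUnion A θ.2.2) l θ.1 y) := by
    -- The moving endpoint `l' y` can flip membership only at `t = l' y`, a single point.
    filter_upwards [ae_eventually_mem_lineSet_iff l hne,
      Measure.ae_ne volume (l ⬝ᵥ y.ofLp)] with t ht hty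
    have hc : ContinuousAt (fun p : EuclideanSpace ℝ (Fin d) × LineParam d m => l ⬝ᵥ p.1.ofLp)
        (y, θ) := Continuous.continuousAt (by fun_prop)
    have hle : ∀ᶠ p : EuclideanSpace ℝ (Fin d) × LineParam d m in 𝓝 (y, θ),
        (t ≤ l ⬝ᵥ p.1.ofLp ↔ t ≤ l ⬝ᵥ y.ofLp) := by
      rcases lt_or_gt_of_ne hty with h | h
      · filter_upwards [hc.eventually_const_lt h] with p hp
        exact ⟨fun _ => h.le, fun _ => hp.le⟩
      · filter_upwards [hc.eventually_lt_const h] with p hp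
        exact ⟨fun h' => absurd h' hp.not_ge, fun h' => absurd h' h.not_ge⟩
    filter_upwards [ht, hle] with p hp1 hp2
    exact and_congr hp2 hp1
  exact continuousAt_integral_indicator_gaussianPDFReal (p₀ := (y, θ))
    (B := fun p => Set.Iic (l ⬝ᵥ p.1.ofLp) ∩ lineSet (extPolyhedralUnion A p.2.2.2) l p.2.1 p.1)
    (fun p => measurableSet_Iic.inter
      (measurableSet_lineSet (measurableSet_extPolyhedralUnion _) _ _ _)) hB hvc hv

/-- The parameters at which the normalized truncated normal distribution function is
nondegenerate. -/
def regularSet (A : ∀ k, Matrix (Fin (m k)) (Fin d) ℝ) (l : Fin d → ℝ) :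
    Set (EuclideanSpace ℝ (Fin d) × LineParam d m) :=
  {p | p.1 ∈ extPolyhedralUnion A p.2.2.2 ∧ 0 < p.2.2.1 ∧
    0 < lineNumer (extPolyhedralUnion A p.2.2.2) l p.2.1 p.2.2.1 p.1 ∧
    lineNumer (extPolyhedralUnion A p.2.2.2) l p.2.1 p.2.2.1 p.1 <
      lineDenom (extPolyhedralUnion A p.2.2.2) l p.2.1 p.2.2.1 p.1}

/-- The regular parameters at which the truncated normal distribution function lies in
`(a, b)`. -/
def insideSet (A : ∀ k, Matrix (Fin (m k)) (Fin d) ℝ) (l : Fin d → ℝ) (a b : ℝ) :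
    Set (EuclideanSpace ℝ (Fin d) × LineParam d m) :=
  {p | p ∈ regularSet A l ∧
    a * lineDenom (extPolyhedralUnion A p.2.2.2) l p.2.1 p.2.2.1 p.1 <
      lineNumer (extPolyhedralUnion A p.2.2.2) l p.2.1 p.2.2.1 p.1 ∧
    lineNumer (extPolyhedralUnion A p.2.2.2) l p.2.1 p.2.2.1 p.1 <
      b * lineDenom (extPolyhedralUnion A p.2.2.2) l p.2.1 p.2.2.1 p.1}

/-- The parameters outside the conditioning event, and the regular ones at which the truncated
normal distribution function lies outside `[a, b]`. -/
def outsideSet (A : ∀ k, Matrix (Fin (m k)) (Fin d) ℝ) (l : Fin d → ℝ) (a b : ℝ) :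
    Set (EuclideanSpace ℝ (Fin d) × LineParam d m) :=
  {p | p.1 ∉ extPolyhedralUnion A p.2.2.2 ∨ (p ∈ regularSet A l ∧
    (lineNumer (extPolyhedralUnion A p.2.2.2) l p.2.1 p.2.2.1 p.1 <
      a * lineDenom (extPolyhedralUnion A p.2.2.2) l p.2.1 p.2.2.1 p.1 ∨
    b * lineDenom (extPolyhedralUnion A p.2.2.2) l p.2.1 p.2.2.1 p.1 <
      lineNumer (extPolyhedralUnion A p.2.2.2) l p.2.1 p.2.2.1 p.1))}

variable {l : Fin d → ℝ} {θ : LineParam d m} {y : EuclideanSpace ℝ (Fin d)}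

theorem eventually_mem_extPolyhedralUnion_iff_prod
    (hne : ∀ k j, (((A k *ᵥ y.ofLp) j : ℝ) : EReal) ≠ θ.2.2 k j) :
    ∀ᶠ p : EuclideanSpace ℝ (Fin d) × LineParam d m in 𝓝 (y, θ),
      (p.1 ∈ extPolyhedralUnion A p.2.2.2 ↔ y ∈ extPolyhedralUnion A θ.2.2) :=
  eventually_mem_extPolyhedralUnion_iff (p₀ := (y, θ)) (g := fun p => p.1)
    (C := fun p : EuclideanSpace ℝ (Fin d) × LineParam d m => p.2.2.2)
    (Continuous.continuousAt (by fun_prop)) (Continuous.continuousAt (by fun_prop)) hne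

theorem regularSet_mem_nhds (hne : ∀ k j, (((A k *ᵥ y.ofLp) j : ℝ) : EReal) ≠ θ.2.2 k j)
    (h : (y, θ) ∈ regularSet A l) : regularSet A l ∈ 𝓝 (y, θ) := by
  obtain ⟨hy, hv, h0, h1⟩ := h
  have hN := continuousAt_lineNumer l hv hne
  have hD := continuousAt_lineDenom l hv hne
  have hvc : ContinuousAt (fun p : EuclideanSpace ℝ (Fin d) × LineParam d m => p.2.2.1) (y, θ) :=
    Continuous.continuousAt (by fun_prop)
  filter_upwards [eventually_mem_extPolyhedralUnion_iff_prod hne, hvc.eventually_const_lt hv,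
    hN.eventually_const_lt h0, Tendsto.eventually_lt hN hD h1] with p h1 h2 h3 h4
  exact ⟨h1.2 hy, h2, h3, h4⟩

theorem insideSet_mem_nhds {a b : ℝ}
    (hne : ∀ k j, (((A k *ᵥ y.ofLp) j : ℝ) : EReal) ≠ θ.2.2 k j)
    (h : (y, θ) ∈ insideSet A l a b) : insideSet A l a b ∈ 𝓝 (y, θ) := by
  obtain ⟨hr, ha, hb⟩ := h
  have hN := continuousAt_lineNumer l hr.2.1 hne
  have hD := continuousAt_lineDenom l hr.2.1 hne
  filter_upwards [regularSet_mem_nhds hne hr, Tendsto.eventually_lt (hD.const_mul a) hN ha,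
    Tendsto.eventually_lt hN (hD.const_mul b) hb] with p h1 h2 h3
  exact ⟨h1, h2, h3⟩

theorem outsideSet_mem_nhds {a b : ℝ}
    (hne : ∀ k j, (((A k *ᵥ y.ofLp) j : ℝ) : EReal) ≠ θ.2.2 k j)
    (h : (y, θ) ∈ outsideSet A l a b) : outsideSet A l a b ∈ 𝓝 (y, θ) := by
  rcases h with hy | ⟨hr, h⟩
  · filter_upwards [eventually_mem_extPolyhedralUnion_iff_prod hne] with p hp
    exact Or.inl (mt hp.1 hy)
  · have hN := continuousAt_lineNumer l hr.2.1 hne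
    have hD := continuousAt_lineDenom l hr.2.1 hne
    rcases h with h | h
    · filter_upwards [regularSet_mem_nhds hne hr,
        Tendsto.eventually_lt hN (hD.const_mul a) h] with p h1 h2
      exact Or.inr ⟨h1, Or.inl h2⟩
    · filter_upwards [regularSet_mem_nhds hne hr,
        Tendsto.eventually_lt (hD.const_mul b) hN h] with p h1 h2
      exact Or.inr ⟨h1, Or.inr h2⟩

end ExtPolyhedral

/-! ### The limit experiment -/

section Limit

variable {d K : ℕ} {m : Fin K → ℕ} {A : ∀ k, Matrix (Fin (m k)) (Fin d) ℝ} {l : Fin d → ℝ}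
  {S : Matrix (Fin d) (Fin d) ℝ} {C : ∀ k, Fin (m k) → EReal}

theorem ae_mulVec_ne (hS : ∀ x : Fin d → ℝ, x ≠ 0 → 0 < x ⬝ᵥ (S *ᵥ x)) (hS' : S.PosSemidef)
    (hA : ∀ k j, A k j ≠ 0) (C : ∀ k, Fin (m k) → EReal) :
    ∀ᵐ y ∂multivariateGaussian 0 S, ∀ k j, (((A k *ᵥ y.ofLp) j : ℝ) : EReal) ≠ C k j := by
  refine ae_all_iff.2 fun k => ae_all_iff.2 fun j => ?_
  rw [ae_iff]
  -- A real number can equal the cutoff only if the cutoff is finite, so the default value of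
  -- `toReal` at `±∞` is harmless.
  refine measure_mono_null (fun y hy => ?_)
    (multivariateGaussian_hyperplane hS' (hS _ (hA k j)) (C k j).toReal)
  simp only [Set.mem_ofPred_eq, not_not] at hy
  rw [Set.mem_ofPred_eq, ← hy, EReal.toReal_coe]
  rfl

variable (hS : ∀ x : Fin d → ℝ, x ≠ 0 → 0 < x ⬝ᵥ (S *ᵥ x)) (hS' : S.PosSemidef)
  (hA : ∀ k j, A k j ≠ 0) (hl : l ≠ 0)

include hS hS' hl in
theorem ae_mem_regularSet :
    ∀ᵐ y ∂multivariateGaussian 0 S, y ∈ extPolyhedralUnion A C →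
      (y, ((regCoef l S, combVariance l S, C) : LineParam d m)) ∈ regularSet A l := by
  have hv : 0 < combVariance l S := hS l hl
  have hQ := measurableSet_extPolyhedralUnion (A := A) C
  filter_upwards [ae_lineNumer_ne hS' hv hQ (z := 0) ⟨le_rfl, zero_le_one⟩,
    ae_lineNumer_ne hS' hv hQ (z := 1) ⟨zero_le_one, le_rfl⟩] with y h0 h1 hy
  refine ⟨hy, hv, lt_of_le_of_ne (lineNumer_nonneg _ _) ?_,
    lt_of_le_of_ne (lineNumer_le_lineDenom hQ hv _) ?_⟩
  · simpa using (h0 hy).symm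
  · simpa using h1 hy

include hS hS' hl hA in
theorem ae_insideSet_or_outsideSet {a b : ℝ} (ha : 0 ≤ a) (hab : a ≤ b) (hb : b ≤ 1) :
    ∀ᵐ y ∂multivariateGaussian 0 S,
      insideSet A l a b ∈ 𝓝 (y, ((regCoef l S, combVariance l S, C) : LineParam d m)) ∨
      outsideSet A l a b ∈ 𝓝 (y, ((regCoef l S, combVariance l S, C) : LineParam d m)) := by
  have hv : 0 < combVariance l S := hS l hl
  have hQ := measurableSet_extPolyhedralUnion (A := A) C
  filter_upwards [ae_mem_regularSet (A := A) (C := C) hS hS' hl, ae_mulVec_ne hS hS' hA C,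
    ae_lineNumer_ne hS' hv hQ (z := a) ⟨ha, hab.trans hb⟩,
    ae_lineNumer_ne hS' hv hQ (z := b) ⟨ha.trans hab, hb⟩] with y hr hne hya hyb
  by_cases hy : y ∈ extPolyhedralUnion A C
  · rcases lt_or_gt_of_ne (hya hy) with h | h
    · exact Or.inr (outsideSet_mem_nhds hne (Or.inr ⟨hr hy, Or.inl h⟩))
    · rcases lt_or_gt_of_ne (hyb hy) with h' | h'
      · exact Or.inl (insideSet_mem_nhds hne ⟨hr hy, h, h'⟩)
      · exact Or.inr (outsideSet_mem_nhds hne (Or.inr ⟨hr hy, Or.inr h'⟩))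
  · exact Or.inr (outsideSet_mem_nhds hne (Or.inl hy))

include hS hS' hl hA in
theorem multivariateGaussian_insideSet {a b : ℝ} (ha : 0 ≤ a) (hab : a ≤ b) (hb : b ≤ 1) :
    (multivariateGaussian 0 S).real {y | insideSet A l a b ∈
      𝓝 (y, ((regCoef l S, combVariance l S, C) : LineParam d m))} =
      (b - a) * (multivariateGaussian 0 S).real (extPolyhedralUnion A C) := by
  have hv : 0 < combVariance l S := hS l hl
  have hQ := measurableSet_extPolyhedralUnion (A := A) C
  rw [← multivariateGaussian_lineNumer_mem_Ioo hS' hv hQ ha hab hb]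
  refine measureReal_congr ?_
  filter_upwards [ae_mem_regularSet (A := A) (C := C) hS hS' hl,
    ae_mulVec_ne hS hS' hA C] with y hr hne
  refine propext ⟨fun h => ?_, fun h => ?_⟩
  · obtain ⟨h1, h2, h3⟩ := mem_of_mem_nhds h
    exact ⟨h1.1, h2, h3⟩
  · exact insideSet_mem_nhds hne ⟨hr h.1, h.2.1, h.2.2⟩

end Limit

/-! ### Dependence of the truncated normal distribution function on the mean -/

section Mgf

variable {Ω : Type*} [MeasurableSpace Ω] {ρ : Measure Ω} {X : Ω → ℝ}

theorem antitone_mgf_of_nonpos (hX : ∀ᵐ ω ∂ρ, X ω ≤ 0)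
    (hint : ∀ t, Integrable (fun ω => Real.exp (t * X ω)) ρ) : Antitone (mgf X ρ) := by
  intro s t hst
  refine integral_mono_ae (hint t) (hint s) ?_
  filter_upwards [hX] with ω hω
  exact Real.exp_le_exp.2 (mul_le_mul_of_nonpos_right hst hω)

theorem tendsto_mgf_atTop_of_neg [IsFiniteMeasure ρ] (hX : ∀ᵐ ω ∂ρ, X ω < 0)
    (hint : ∀ t, Integrable (fun ω => Real.exp (t * X ω)) ρ) :
    Tendsto (mgf X ρ) atTop (𝓝 0) := by
  rw [← integral_zero Ω ℝ (μ := ρ)]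
  refine tendsto_integral_filter_of_dominated_convergence (fun _ => 1)
    (Eventually.of_forall fun t => (hint t).aestronglyMeasurable) ?_ (integrable_const _) ?_
  · filter_upwards [eventually_ge_atTop 0] with t ht
    filter_upwards [hX] with ω hω
    rw [Real.norm_eq_abs, Real.abs_exp, Real.exp_le_one_iff]
    exact mul_nonpos_of_nonneg_of_nonpos ht hω.le
  · filter_upwards [hX] with ω hω
    exact Real.tendsto_exp_atBot.comp (tendsto_id.atTop_mul_const_of_neg hω)

/-- The ratio of the moment generating function of a negative random variable to its sum with that
of a positive one is decreasing and takes every value in `(0, 1)`. -/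
theorem mgf_div_add_mgf {Ω' : Type*} [MeasurableSpace Ω'] {ρ' : Measure Ω'} {X' : Ω' → ℝ}
    [IsFiniteMeasure ρ] [IsFiniteMeasure ρ'] [NeZero ρ] [NeZero ρ']
    (hX : ∀ᵐ ω ∂ρ, X ω < 0) (hint : ∀ t, Integrable (fun ω => Real.exp (t * X ω)) ρ)
    (hX' : ∀ᵐ ω ∂ρ', 0 < X' ω) (hint' : ∀ t, Integrable (fun ω => Real.exp (t * X' ω)) ρ') :
    Antitone (fun h => mgf X ρ h / (mgf X ρ h + mgf X' ρ' h)) ∧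
      ∀ q ∈ Set.Ioo (0 : ℝ) 1, ∃ h, mgf X ρ h / (mgf X ρ h + mgf X' ρ' h) = q := by
  have hpos : ∀ h, 0 < mgf X ρ h := fun h => mgf_pos_iff.2 (hint h)
  have hpos' : ∀ h, 0 < mgf X' ρ' h := fun h => mgf_pos_iff.2 (hint' h)
  have hneg : ∀ t, Integrable (fun ω => Real.exp (t * (-X') ω)) ρ' := fun t => by
    simpa using hint' (-t)
  have hXneg : ∀ᵐ ω ∂ρ', (-X') ω < 0 := by
    filter_upwards [hX'] with ω hω
    simpa using hω
  have hmgf : ∀ h, mgf X' ρ' h = mgf (-X') ρ' (-h) := fun h => by simp [mgf_neg]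
  have hanti := antitone_mgf_of_nonpos (hX.mono fun _ => le_of_lt) hint
  have hmono : Monotone (mgf X' ρ') := fun s t hst => by
    rw [hmgf, hmgf]
    exact antitone_mgf_of_nonpos (hXneg.mono fun _ => le_of_lt) hneg (neg_le_neg hst)
  have htop := tendsto_mgf_atTop_of_neg hX hint
  have hbot : Tendsto (mgf X' ρ') atBot (𝓝 0) := by
    refine ((tendsto_mgf_atTop_of_neg hXneg hneg).comp tendsto_neg_atBot_atTop).congr fun h => ?_
    exact (hmgf h).symm
  refine ⟨fun s t hst => ?_, fun q hq => ?_⟩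
  · rw [div_le_div_iff₀ (add_pos (hpos _) (hpos' _)) (add_pos (hpos _) (hpos' _))]
    have := mul_le_mul (hanti hst) (hmono hst) (hpos' _).le (hpos _).le
    nlinarith
  · refine mem_range_of_exists_le_of_exists_ge (f := fun h => mgf X ρ h /
      (mgf X ρ h + mgf X' ρ' h)) ?_ ?_ ?_
    · exact (continuous_mgf hint).div ((continuous_mgf hint).add (continuous_mgf hint'))
        fun h => (add_pos (hpos _) (hpos' _)).ne'
    · have h1 : 0 < q * mgf X' ρ' 0 := mul_pos hq.1 (hpos' 0)
      obtain ⟨h, hh, hh0⟩ := ((htop.eventually_le_const h1).and (eventually_ge_atTop 0)).exists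
      refine ⟨h, ?_⟩
      rw [div_le_iff₀ (add_pos (hpos _) (hpos' _))]
      have := mul_le_mul_of_nonneg_left (hmono hh0) hq.1.le
      nlinarith [mul_pos hq.1 (hpos h)]
    · have h1 : 0 < (1 - q) * mgf X ρ 0 := mul_pos (sub_pos.2 hq.2) (hpos 0)
      obtain ⟨h, hh, hh0⟩ := ((hbot.eventually_le_const h1).and (eventually_le_atBot 0)).exists
      refine ⟨h, ?_⟩
      rw [le_div_iff₀ (add_pos (hpos _) (hpos' _))]
      have := mul_le_mul_of_nonneg_left (hanti hh0) (sub_pos.2 hq.2).le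
      nlinarith [mul_pos (sub_pos.2 hq.2) (hpos' h), mul_pos hq.1 (hpos' h)]

end Mgf

/-! ### Exponential tilting of the truncated normal law -/

theorem gaussianPDFReal_sub_div_sqrt {v : ℝ} (hv : 0 < v) (μ t : ℝ) :
    gaussianPDFReal 0 1 ((t - μ) / √v) = √v * gaussianPDFReal μ v.toNNReal t := by
  rw [gaussianPDFReal_div_sqrt hv, gaussianPDFReal_sub, zero_add]

theorem integral_indicator_gaussianPDFReal_sub_div_sqrt {v : ℝ} (hv : 0 < v) (μ : ℝ) {B : Set ℝ}
    (hB : MeasurableSet B) :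
    ∫ t, B.indicator (fun t => gaussianPDFReal 0 1 ((t - μ) / √v)) t =
      √v * (gaussianReal μ v.toNNReal).real B := by
  have hv' : v.toNNReal ≠ 0 := by simpa using hv
  rw [measureReal_def, gaussianReal_apply_eq_integral μ hv' B, ENNReal.toReal_ofReal
    (integral_nonneg fun t => gaussianPDFReal_nonneg _ _ _), integral_indicator hB,
    ← integral_const_mul]
  simp_rw [gaussianPDFReal_sub_div_sqrt hv]

theorem setIntegral_Iic_indicator {T : Set ℝ} (z : ℝ) (f : ℝ → ℝ) :
    ∫ t in Set.Iic z, T.indicator f t = ∫ t, (Set.Iic z ∩ T).indicator f t := by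
  rw [← integral_indicator measurableSet_Iic, Set.indicator_indicator]

theorem truncNormalCDF_eq {v : ℝ} (hv : 0 < v) (z μ : ℝ) {T : Set ℝ} (hT : MeasurableSet T) :
    truncNormalCDF z μ v T = (gaussianReal μ v.toNNReal).real (Set.Iic z ∩ T) /
      ((gaussianReal μ v.toNNReal).real (Set.Iic z ∩ T) +
        (gaussianReal μ v.toNNReal).real (Set.Ioi z ∩ T)) := by
  have hsplit : (gaussianReal μ v.toNNReal).real (Set.Iic z ∩ T) +
      (gaussianReal μ v.toNNReal).real (Set.Ioi z ∩ T) = (gaussianReal μ v.toNNReal).real T := by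
    rw [← measureReal_union _ (measurableSet_Ioi.inter hT), ← Set.union_inter_distrib_right,
      Set.Iic_union_Ioi, Set.univ_inter]
    exact (Set.Iic_disjoint_Ioi le_rfl).mono Set.inter_subset_left Set.inter_subset_left
  rw [hsplit, truncNormalCDF, setIntegral_Iic_indicator,
    integral_indicator_gaussianPDFReal_sub_div_sqrt hv μ (measurableSet_Iic.inter hT),
    integral_indicator_gaussianPDFReal_sub_div_sqrt hv μ hT,
    mul_div_mul_left _ _ (Real.sqrt_pos.2 hv).ne']

theorem gaussianReal_eq_mul_setIntegral_exp {v : ℝ} (hv : 0 < v) (z μ₀ μ : ℝ) :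
    ∃ κ > 0, ∀ B : Set ℝ, MeasurableSet B → (gaussianReal μ v.toNNReal).real B =
      κ * ∫ t in B, Real.exp ((μ - μ₀) * ((t - z) / v)) ∂gaussianReal μ₀ v.toNNReal := by
  have hv' : v.toNNReal ≠ 0 := by simpa using hv
  -- The ratio of the two normal densities is `exp ((μ - μ₀) t / v - (μ² - μ₀²) / (2 v))`;
  -- substituting `t = z + (t - z)` leaves this constant. Centring at `z` gives the exponent
  -- opposite signs on the two sides of `z`.
  refine ⟨Real.exp ((μ - μ₀) * z / v - (μ ^ 2 - μ₀ ^ 2) / (2 * v)), Real.exp_pos _,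
    fun B hB => ?_⟩
  rw [← integral_indicator hB, integral_gaussianReal_eq_integral_smul hv', measureReal_def,
    gaussianReal_apply_eq_integral μ hv' B, ENNReal.toReal_ofReal
    (integral_nonneg fun t => gaussianPDFReal_nonneg _ _ _), ← integral_indicator hB,
    ← integral_const_mul]
  congr 1
  ext t
  by_cases ht : t ∈ B
  · simp only [ht, Set.indicator_of_mem, smul_eq_mul, gaussianPDFReal, Real.coe_toNNReal _ hv.le]
    rw [show ∀ a b c e : ℝ, a * (b * c * e) = b * (a * c * e) by intros; ring, ← Real.exp_add,
      ← Real.exp_add]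
    congr 2
    field_simp
    ring
  · simp [ht]

/-- At a mean for which the truncated normal distribution function is strictly between `0` and `1`
(in fact, then, at all means), it is decreasing in the mean and attains every level. -/
theorem truncNormalCDF_antitone_and_surjOn {v : ℝ} (hv : 0 < v) {z μ₀ : ℝ} {T : Set ℝ}
    (hT : MeasurableSet T) (h₁ : 0 < (gaussianReal μ₀ v.toNNReal).real (Set.Iic z ∩ T))
    (h₂ : 0 < (gaussianReal μ₀ v.toNNReal).real (Set.Ioi z ∩ T)) :
    Antitone (fun u => truncNormalCDF z u v T) ∧
      ∀ q ∈ Set.Ioo (0 : ℝ) 1, ∃ u, truncNormalCDF z u v T = q := by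
  set G := gaussianReal μ₀ v.toNNReal with hG
  have hv' : v.toNNReal ≠ 0 := by simpa using hv
  have : NullSingletonClass G := nullSingletonClass_gaussianReal hv'
  have hB₁ : MeasurableSet (Set.Iic z ∩ T) := measurableSet_Iic.inter hT
  have hB₂ : MeasurableSet (Set.Ioi z ∩ T) := measurableSet_Ioi.inter hT
  have hne : ∀ B : Set ℝ, 0 < G.real B → NeZero (G.restrict B) := fun B hB => ⟨fun h => by
    rw [Measure.restrict_eq_zero] at h
    simp [measureReal_def, h] at hB⟩
  have := hne _ h₁
  have := hne _ h₂
  have hX₁ : ∀ᵐ t ∂G.restrict (Set.Iic z ∩ T), (t - z) / v < 0 := by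
    filter_upwards [ae_restrict_mem hB₁, ae_restrict_of_ae (Measure.ae_ne G z)] with t ht hne
    exact div_neg_of_neg_of_pos (sub_neg.2 (lt_of_le_of_ne ht.1 hne)) hv
  have hX₂ : ∀ᵐ t ∂G.restrict (Set.Ioi z ∩ T), 0 < (t - z) / v := by
    filter_upwards [ae_restrict_mem hB₂] with t ht
    exact div_pos (sub_pos.2 ht.1) hv
  have hint : ∀ h, Integrable (fun t => Real.exp (h * ((t - z) / v))) G := fun h => by
    refine ((integrable_exp_mul_gaussianReal (h / v)).const_mul
      (Real.exp (-(h * z / v)))).congr (Eventually.of_forall fun t => ?_)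
    simp only
    rw [← Real.exp_add]
    congr 1
    field_simp
    ring
  obtain ⟨hanti, hsurj⟩ := mgf_div_add_mgf hX₁ (fun h => (hint h).restrict) hX₂
    (fun h => (hint h).restrict)
  have hF : ∀ u, truncNormalCDF z u v T =
      (fun h => mgf (fun t => (t - z) / v) (G.restrict (Set.Iic z ∩ T)) h /
        (mgf (fun t => (t - z) / v) (G.restrict (Set.Iic z ∩ T)) h +
          mgf (fun t => (t - z) / v) (G.restrict (Set.Ioi z ∩ T)) h)) (u - μ₀) := by
    intro u
    obtain ⟨κ, hκ, hB⟩ := gaussianReal_eq_mul_setIntegral_exp hv z μ₀ u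
    rw [truncNormalCDF_eq hv z u hT, hB _ hB₁, hB _ hB₂, ← mul_add, mul_div_mul_left _ _ hκ.ne']
    rfl
  refine ⟨fun s t hst => ?_, fun q hq => ?_⟩
  · simp only [hF]
    exact hanti (sub_le_sub_right hst _)
  · obtain ⟨h, hh⟩ := hsurj q hq
    exact ⟨h + μ₀, by rw [hF, add_sub_cancel_right]; exact hh⟩

/-! ### The plug-in estimator in normalized coordinates -/

section Scaling

variable {d K : ℕ} {m : Fin K → ℕ} {A : ∀ k, Matrix (Fin (m k)) (Fin d) ℝ} {l : Fin d → ℝ}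

theorem polyhedralUnion_eq_extPolyhedralUnion (c : ∀ k, EuclideanSpace ℝ (Fin (m k))) :
    polyhedralUnion A c = extPolyhedralUnion A fun k j => ((c k j : ℝ) : EReal) := by
  ext b
  simp [polyhedralUnion, extPolyhedralUnion]

/-- Along the line each constraint is affine in `t` with slope `(A γ)_j`. Dividing by the slope
gives a lower bound, an upper bound or, when it vanishes, a condition free of `t`: these are `Z⁻`,
`Z⁺` and `Z⁰`. -/
theorem truncSet_eq_lineSet (S : Matrix (Fin d) (Fin d) ℝ)
    (c : ∀ k, EuclideanSpace ℝ (Fin (m k))) (b : EuclideanSpace ℝ (Fin d)) :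
    truncSet A l S c b = lineSet (polyhedralUnion A c) l (regCoef l S) b := by
  ext t
  simp only [truncSet, lineSet, polyhedralUnion, Set.mem_iUnion, Set.mem_ofPred_eq, truncZero,
    truncLower, truncUpper, le_iInf_iff, iSup_le_iff, EReal.coe_le_coe_iff, EReal.coe_nonneg]
  refine exists_congr fun k => ?_
  have hlin : ∀ j, (A k *ᵥ (b + (t - l ⬝ᵥ b.ofLp) • WithLp.toLp 2 (regCoef l S)).ofLp) j =
      (A k *ᵥ regResidual l S b) j + t * (A k *ᵥ regCoef l S) j := fun j => by
    simp only [regResidual, WithLp.ofLp_add, WithLp.ofLp_smul, Matrix.mulVec_add,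
      Matrix.mulVec_smul, Matrix.mulVec_sub, Pi.add_apply, Pi.sub_apply, Pi.smul_apply, smul_eq_mul]
    ring
  simp only [hlin]
  constructor
  · rintro ⟨h0, h1, h2⟩ j
    rcases lt_trichotomy ((A k *ᵥ regCoef l S) j) 0 with h | h | h
    · have := (div_le_iff_of_neg h).1 (h1 j h)
      linarith
    · have := h0 j h
      rw [h]
      linarith
    · have := (le_div_iff₀ h).1 (h2 j h)
      linarith
  · intro h
    refine ⟨fun j hj => ?_, fun j hj => ?_, fun j hj => ?_⟩
    · have := h j
      rw [hj] at this
      linarith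
    · rw [div_le_iff_of_neg hj]
      linarith [h j]
    · rw [le_div_iff₀ hj]
      linarith [h j]

/-- The cutoffs of the conditioning event in the coordinates `r (b - β)`. -/
def scaledCutoff (A : ∀ k, Matrix (Fin (m k)) (Fin d) ℝ) (r : ℝ) (β : EuclideanSpace ℝ (Fin d))
    (c : ∀ k, EuclideanSpace ℝ (Fin (m k))) (k : Fin K) (j : Fin (m k)) : EReal :=
  (((r • c k) j : ℝ) : EReal) + ((-(A k *ᵥ (r • β).ofLp) j : ℝ) : EReal)

variable {r : ℝ} {β b : EuclideanSpace ℝ (Fin d)} {c : ∀ k, EuclideanSpace ℝ (Fin (m k))}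

theorem smul_sub_smul_mem_extPolyhedralUnion (hr : 0 < r) :
    r • b - r • β ∈ extPolyhedralUnion A (scaledCutoff A r β c) ↔ b ∈ polyhedralUnion A c := by
  simp only [extPolyhedralUnion, scaledCutoff, polyhedralUnion, Set.mem_ofPred_eq, Set.mem_iUnion,
    ← EReal.coe_add, EReal.coe_le_coe_iff]
  refine exists_congr fun k => forall_congr' fun j => ?_
  simp only [WithLp.ofLp_sub, WithLp.ofLp_smul, Matrix.mulVec_sub, Matrix.mulVec_smul,
    Pi.sub_apply, Pi.smul_apply, smul_eq_mul, PiLp.smul_apply]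
  rw [sub_eq_add_neg, add_le_add_iff_right, mul_le_mul_iff_right₀ hr]

/-- Normalizing the data acts on the line coordinate by the affine map `s ↦ l' β + s / r`, which
sends `0` to the true mean. -/
theorem mem_lineSet_scaled (hr : 0 < r) (γ : Fin d → ℝ) (s : ℝ) :
    s ∈ lineSet (extPolyhedralUnion A (scaledCutoff A r β c)) l γ (r • b - r • β) ↔
      l ⬝ᵥ β.ofLp + s / r ∈ lineSet (polyhedralUnion A c) l γ b := by
  rw [lineSet, lineSet, Set.mem_ofPred_eq, Set.mem_ofPred_eq,
    ← smul_sub_smul_mem_extPolyhedralUnion (β := β) hr]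
  have : r • b - r • β + (s - l ⬝ᵥ (r • b - r • β).ofLp) • WithLp.toLp 2 γ =
      r • (b + (l ⬝ᵥ β.ofLp + s / r - l ⬝ᵥ b.ofLp) • WithLp.toLp 2 γ) - r • β := by
    have hs : s - l ⬝ᵥ (r • b - r • β).ofLp = r * (l ⬝ᵥ β.ofLp + s / r - l ⬝ᵥ b.ofLp) := by
      simp only [WithLp.ofLp_sub, WithLp.ofLp_smul, dotProduct_sub, dotProduct_smul, smul_eq_mul]
      field_simp
      ring
    rw [hs, smul_add, smul_smul]
    abel
  rw [this]

theorem integral_affine {r : ℝ} (hr : 0 < r) (a : ℝ) (f : ℝ → ℝ) :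
    ∫ s, f (a + s / r) = r * ∫ t, f t := by
  rw [Measure.integral_comp_div (fun t => f (a + t)) r, integral_add_left_eq_self f a,
    abs_of_pos hr, smul_eq_mul]

theorem gaussianPDFReal_scaled (hr : 0 < r) {v : ℝ} (a s : ℝ) :
    gaussianPDFReal 0 1 (s / √(r ^ 2 * v)) = gaussianPDFReal 0 1 ((a + s / r - a) / √v) := by
  rw [Real.sqrt_mul (sq_nonneg r), Real.sqrt_sq hr.le, add_sub_cancel_left, div_div]

theorem measurableSet_polyhedralUnion (c : ∀ k, EuclideanSpace ℝ (Fin (m k))) :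
    MeasurableSet (polyhedralUnion A c) := by
  rw [polyhedralUnion_eq_extPolyhedralUnion]
  exact measurableSet_extPolyhedralUnion _

theorem lineDenom_scaled (hr : 0 < r) {v : ℝ} (hv : 0 < v) (γ : Fin d → ℝ) :
    lineDenom (extPolyhedralUnion A (scaledCutoff A r β c)) l γ (r ^ 2 * v) (r • b - r • β) =
      r * √v * (gaussianReal (l ⬝ᵥ β.ofLp) v.toNNReal).real
        (lineSet (polyhedralUnion A c) l γ b) := by
  rw [mul_assoc, ← integral_indicator_gaussianPDFReal_sub_div_sqrt hv _
    (measurableSet_lineSet (measurableSet_polyhedralUnion c) _ _ _),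
    ← integral_affine hr (l ⬝ᵥ β.ofLp), lineDenom]
  congr 1
  ext s
  classical
  rw [Set.indicator_apply, Set.indicator_apply]
  simp only [mem_lineSet_scaled hr, gaussianPDFReal_scaled hr (l ⬝ᵥ β.ofLp) s]

theorem lineNumer_scaled (hr : 0 < r) {v : ℝ} (hv : 0 < v) (γ : Fin d → ℝ) :
    lineNumer (extPolyhedralUnion A (scaledCutoff A r β c)) l γ (r ^ 2 * v) (r • b - r • β) =
      r * √v * (gaussianReal (l ⬝ᵥ β.ofLp) v.toNNReal).real
        (Set.Iic (l ⬝ᵥ b.ofLp) ∩ lineSet (polyhedralUnion A c) l γ b) := by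
  rw [mul_assoc, ← integral_indicator_gaussianPDFReal_sub_div_sqrt hv _
    (measurableSet_Iic.inter (measurableSet_lineSet (measurableSet_polyhedralUnion c) _ _ _)),
    ← integral_affine hr (l ⬝ᵥ β.ofLp), lineNumer]
  congr 1
  ext s
  have hle : s ≤ l ⬝ᵥ (r • b - r • β).ofLp ↔ l ⬝ᵥ β.ofLp + s / r ≤ l ⬝ᵥ b.ofLp := by
    rw [← le_sub_iff_add_le', div_le_iff₀ hr]
    simp only [WithLp.ofLp_sub, WithLp.ofLp_smul, dotProduct_sub, dotProduct_smul, smul_eq_mul]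
    rw [sub_mul, mul_comm r, mul_comm r]
  classical
  rw [Set.indicator_apply, Set.indicator_apply]
  simp only [Set.mem_inter_iff, Set.mem_Iic, hle, mem_lineSet_scaled hr,
    gaussianPDFReal_scaled hr (l ⬝ᵥ β.ofLp) s]

theorem combVariance_smul (a : ℝ) (S : Matrix (Fin d) (Fin d) ℝ) :
    combVariance l (a • S) = a * combVariance l S := by
  simp [combVariance, Matrix.smul_mulVec]

theorem regCoef_smul {a : ℝ} (ha : a ≠ 0) (S : Matrix (Fin d) (Fin d) ℝ) :
    regCoef l (a • S) = regCoef l S := by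
  rw [regCoef, regCoef, combVariance_smul, Matrix.smul_mulVec, smul_smul, mul_inv, mul_comm a⁻¹,
    mul_assoc, inv_mul_cancel₀ ha, mul_one]

/-- The normalized direction, variance and cutoffs for a sample of size `n`. -/
def scaledParam (A : ∀ k, Matrix (Fin (m k)) (Fin d) ℝ) (l : Fin d → ℝ) (n : ℕ)
    (S : Matrix (Fin d) (Fin d) ℝ) (β : EuclideanSpace ℝ (Fin d))
    (c : ∀ k, EuclideanSpace ℝ (Fin (m k))) : LineParam d m :=
  (regCoef l ((n : ℝ) • S), combVariance l ((n : ℝ) • S), scaledCutoff A (√n) β c)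

/-- Regularity puts mass on both sides of the data point, so the distribution function attains `q`
and is antitone in the mean. Its value at `l' β` is `N / D`; a strict comparison with `q` orders the
means strictly, so strict monotonicity and uniqueness of the solution are not needed. -/
theorem mul_lineDenom_lt_lineNumer_imp {n : ℕ} (hn : 1 ≤ n) {S : Matrix (Fin d) (Fin d) ℝ}
    (h : (√(n : ℝ) • b - √(n : ℝ) • β, scaledParam A l n S β c) ∈ regularSet A l) {q : ℝ}
    (hq : q ∈ Set.Ioo (0 : ℝ) 1) :
    (∃ u, truncNormalCDF (l ⬝ᵥ b.ofLp) u (combVariance l S) (truncSet A l S c b) = q) ∧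
    ∀ u, truncNormalCDF (l ⬝ᵥ b.ofLp) u (combVariance l S) (truncSet A l S c b) = q →
      (q * lineDenom (extPolyhedralUnion A (scaledCutoff A (√n) β c)) l (regCoef l ((n : ℝ) • S))
          (combVariance l ((n : ℝ) • S)) (√(n : ℝ) • b - √(n : ℝ) • β) <
        lineNumer (extPolyhedralUnion A (scaledCutoff A (√n) β c)) l (regCoef l ((n : ℝ) • S))
          (combVariance l ((n : ℝ) • S)) (√(n : ℝ) • b - √(n : ℝ) • β) → l ⬝ᵥ β.ofLp < u) ∧
      (lineNumer (extPolyhedralUnion A (scaledCutoff A (√n) β c)) l (regCoef l ((n : ℝ) • S))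
          (combVariance l ((n : ℝ) • S)) (√(n : ℝ) • b - √(n : ℝ) • β) <
        q * lineDenom (extPolyhedralUnion A (scaledCutoff A (√n) β c)) l (regCoef l ((n : ℝ) • S))
          (combVariance l ((n : ℝ) • S)) (√(n : ℝ) • b - √(n : ℝ) • β) → u < l ⬝ᵥ β.ofLp) := by
  have hn0 : (0 : ℝ) < n := by exact_mod_cast hn
  have hr : 0 < √(n : ℝ) := Real.sqrt_pos.2 hn0
  obtain ⟨-, hv', h0, h1⟩ := h
  simp only [scaledParam] at hv' h0 h1
  rw [truncSet_eq_lineSet]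
  rw [combVariance_smul] at hv' h0 h1 ⊢
  have hv : 0 < combVariance l S := (mul_pos_iff_of_pos_left hn0).1 hv'
  have hsq : (n : ℝ) * combVariance l S = √(n : ℝ) ^ 2 * combVariance l S := by
    rw [Real.sq_sqrt hn0.le]
  rw [regCoef_smul hn0.ne', hsq, lineNumer_scaled hr hv] at h0 h1
  rw [lineDenom_scaled hr hv] at h1
  rw [regCoef_smul hn0.ne', hsq, lineNumer_scaled hr hv, lineDenom_scaled hr hv]
  set T := lineSet (polyhedralUnion A c) l (regCoef l S) b with hT
  have hTm : MeasurableSet T := measurableSet_lineSet (measurableSet_polyhedralUnion c) _ _ _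
  set z := l ⬝ᵥ b.ofLp
  set G := gaussianReal (l ⬝ᵥ β.ofLp) (combVariance l S).toNNReal
  have hκ : 0 < √(n : ℝ) * √(combVariance l S) := mul_pos hr (Real.sqrt_pos.2 hv)
  have hsplit : G.real (Set.Iic z ∩ T) + G.real (Set.Ioi z ∩ T) = G.real T := by
    rw [← measureReal_union _ (measurableSet_Ioi.inter hTm), ← Set.union_inter_distrib_right,
      Set.Iic_union_Ioi, Set.univ_inter]
    exact (Set.Iic_disjoint_Ioi le_rfl).mono Set.inter_subset_left Set.inter_subset_left
  have h0' : 0 < G.real (Set.Iic z ∩ T) := (mul_pos_iff_of_pos_left hκ).1 h0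
  have h1' : G.real (Set.Iic z ∩ T) < G.real T := lt_of_mul_lt_mul_left h1 hκ.le
  obtain ⟨hanti, hsurj⟩ := truncNormalCDF_antitone_and_surjOn hv hTm h0' (by linarith)
  have hβ : truncNormalCDF z (l ⬝ᵥ β.ofLp) (combVariance l S) T =
      G.real (Set.Iic z ∩ T) / G.real T := by
    rw [truncNormalCDF_eq hv _ _ hTm, hsplit]
  have hTpos : 0 < G.real T := h0'.trans h1'
  refine ⟨hsurj q hq, fun u hu => ⟨fun hlt => ?_, fun hlt => ?_⟩⟩
  · by_contra hge
    have := hanti (not_lt.1 hge)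
    simp only [hu, hβ] at this
    rw [div_le_iff₀ hTpos] at this
    rw [mul_left_comm] at hlt
    exact absurd (lt_of_mul_lt_mul_left hlt hκ.le) this.not_gt
  · by_contra hge
    have := hanti (not_lt.1 hge)
    simp only [hu, hβ] at this
    rw [le_div_iff₀ hTpos] at this
    rw [mul_left_comm] at hlt
    exact absurd (lt_of_mul_lt_mul_left hlt hκ.le) this.not_gt

end Scaling

/-! ### Uniform limits as limits along ultrafilters -/

section Uniform

variable {X : ℕ → Type*} [∀ n, MeasurableSpace (X n)] {cP : ∀ n, Set (ProbabilityMeasure (X n))}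

theorem tendsto_ultrafilter_of_tendsto_iSup {g : ∀ n, ProbabilityMeasure (X n) → ℝ≥0∞}
    (h : Tendsto (fun n => ⨆ P ∈ cP n, g n P) atTop (𝓝 0))
    {U : Ultrafilter (Σ n, ProbabilityMeasure (X n))} (hfst : Tendsto (fun i : Σ n, ProbabilityMeasure (X n) => i.1) U atTop)
    (hmem : ∀ᶠ i in (U : Filter (Σ n, ProbabilityMeasure (X n))), i.2 ∈ cP i.1) :
    Tendsto (fun i : Σ n, ProbabilityMeasure (X n) => g i.1 i.2) U (𝓝 0) := by
  refine tendsto_of_tendsto_of_tendsto_of_le_of_le' tendsto_const_nhds (h.comp hfst)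
    (Eventually.of_forall fun _ => zero_le) ?_
  filter_upwards [hmem] with i hi
  exact le_iSup₂ (f := fun P (_ : P ∈ cP i.1) => g i.1 P) i.2 hi

/-- A uniform limit is a limit along the filter of pairs `(n, P)` with `n → ∞` and `P ∈ cP n`, and
this can be tested on ultrafilters. Ultrafilters replace extraction of subsequences and supply all
the compactness limits at once. -/
theorem tendsto_iSup_of_tendsto_ultrafilter {g : ∀ n, ProbabilityMeasure (X n) → ℝ≥0∞}
    (h : ∀ U : Ultrafilter (Σ n, ProbabilityMeasure (X n)),
      Tendsto (fun i : Σ n, ProbabilityMeasure (X n) => i.1) U atTop →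
      (∀ᶠ i in (U : Filter (Σ n, ProbabilityMeasure (X n))), i.2 ∈ cP i.1) →
      Tendsto (fun i : Σ n, ProbabilityMeasure (X n) => g i.1 i.2) U (𝓝 0)) :
    Tendsto (fun n => ⨆ P ∈ cP n, g n P) atTop (𝓝 0) := by
  have hL : Tendsto (fun i : Σ n, ProbabilityMeasure (X n) => g i.1 i.2)
      (comap Sigma.fst atTop ⊓ 𝓟 {i | i.2 ∈ cP i.1}) (𝓝 0) := by
    rw [tendsto_iff_ultrafilter]
    intro U hU
    exact h U (tendsto_comap.mono_left (hU.trans inf_le_left))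
      (le_principal_iff.1 (hU.trans inf_le_right))
  rw [ENNReal.tendsto_nhds_zero] at hL ⊢
  intro ε hε
  have := hL ε hε
  rw [eventually_inf_principal, eventually_comap] at this
  filter_upwards [this] with n hn
  exact iSup₂_le fun P hP => hn ⟨n, P⟩ rfl hP

end Uniform

/-! ### Limits along an ultrafilter and assembly of the proof -/

section Assembly

variable {X : ℕ → Type*} [∀ n, MeasurableSpace (X n)] {cP : ∀ n, Set (ProbabilityMeasure (X n))}
  {d K : ℕ} {m : Fin K → ℕ} {l : Fin d → ℝ}
  {A : ∀ k, Matrix (Fin (m k)) (Fin d) ℝ}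
  {bhat : ∀ n, X n → EuclideanSpace ℝ (Fin d)} {Shat : ∀ n, X n → Matrix (Fin d) (Fin d) ℝ}
  {chat : ∀ n, X n → ∀ k, EuclideanSpace ℝ (Fin (m k))}
  {β : ∀ n, ProbabilityMeasure (X n) → EuclideanSpace ℝ (Fin d)}
  {S : ∀ n, ProbabilityMeasure (X n) → Matrix (Fin d) (Fin d) ℝ}
  {c : ∀ n, ProbabilityMeasure (X n) → ∀ k, EuclideanSpace ℝ (Fin (m k))}
  {U : Ultrafilter (Σ n, ProbabilityMeasure (X n))}

theorem exists_tendsto_of_uniformAsymptoticNormality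
    (h₁ : UniformAsymptoticNormality cP bhat β S) (hfst : Tendsto (fun i : Σ n, ProbabilityMeasure (X n) => i.1) U atTop)
    (hmem : ∀ᶠ i in (U : Filter (Σ n, ProbabilityMeasure (X n))), i.2 ∈ cP i.1) :
    ∃ (S₀ : Matrix (Fin d) (Fin d) ℝ) (a : ℝ), 0 < a ∧ (S₀ - a • 1).PosSemidef ∧
      Tendsto (fun i : Σ n, ProbabilityMeasure (X n) => S i.1 i.2) U (𝓝 S₀) ∧
      ∀ f ∈ BLOne (EuclideanSpace ℝ (Fin d)),
        Tendsto (fun i : Σ n, ProbabilityMeasure (X n) =>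
          ∫ x, f (√(i.1 : ℝ) • bhat i.1 x - √(i.1 : ℝ) • β i.1 i.2) ∂(i.2 : Measure (X i.1))) U
          (𝓝 (∫ y, f y ∂multivariateGaussian 0 S₀)) := by
  obtain ⟨hconv, lam, hlam, heig⟩ := h₁
  have hev : ∀ᶠ i in (U : Filter (Σ n, ProbabilityMeasure (X n))),
      (S i.1 i.2 - (1 / lam) • 1).PosSemidef ∧ (lam • 1 - S i.1 i.2).PosSemidef := by
    filter_upwards [hmem, hfst.eventually (eventually_ge_atTop 1)] with i hi hi1
    obtain ⟨hH, he⟩ := heig i.1 hi1 i.2 hi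
    exact ⟨sub_smul_one_posSemidef hH fun j => (he j).1,
      smul_one_sub_posSemidef hH fun j => (he j).2⟩
  obtain ⟨S₀, hS₀, hpsd, hG⟩ := exists_tendsto_multivariateGaussian U
    (S := fun i : Σ n, ProbabilityMeasure (X n) => S i.1 i.2) (one_div_pos.2 hlam) hev
  refine ⟨S₀, 1 / lam, one_div_pos.2 hlam, hpsd, hS₀, fun f hf => ?_⟩
  have h := tendsto_ultrafilter_of_tendsto_iSup hconv hfst hmem
  have h' : Tendsto (fun i : Σ n, ProbabilityMeasure (X n) =>
      (∫ x, f (√(i.1 : ℝ) • bhat i.1 x - √(i.1 : ℝ) • β i.1 i.2) ∂(i.2 : Measure (X i.1))) -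
        ∫ y, f y ∂multivariateGaussian 0 (S i.1 i.2)) U (𝓝 0) := by
    rw [tendsto_zero_iff_abs_tendsto_zero]
    have h2 := (ENNReal.tendsto_toReal ENNReal.zero_ne_top).comp
      (tendsto_of_tendsto_of_tendsto_of_le_of_le tendsto_const_nhds h (fun _ => zero_le)
        fun i => le_iSup₂ (f := fun f (_ : f ∈ BLOne (EuclideanSpace ℝ (Fin d))) =>
          ENNReal.ofReal |(∫ x, f (√(i.1 : ℝ) • bhat i.1 x - √(i.1 : ℝ) • β i.1 i.2)
            ∂(i.2 : Measure (X i.1))) - ∫ y, f y ∂multivariateGaussian 0 (S i.1 i.2)|) f hf)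
    refine h2.congr fun i => ?_
    simp [ENNReal.toReal_ofReal]
  simpa using h'.add (hG f hf)

theorem tendstoInProb_of_uniformCovarianceConsistency {S₀ : Matrix (Fin d) (Fin d) ℝ}
    (h₂ : UniformCovarianceConsistency cP Shat S) (hfst : Tendsto (fun i : Σ n, ProbabilityMeasure (X n) => i.1) U atTop)
    (hmem : ∀ᶠ i in (U : Filter (Σ n, ProbabilityMeasure (X n))), i.2 ∈ cP i.1)
    (hS₀ : Tendsto (fun i : Σ n, ProbabilityMeasure (X n) => S i.1 i.2) U (𝓝 S₀)) :
    TendstoInProb (U : Filter (Σ n, ProbabilityMeasure (X n)))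
      (Ω := fun i => X i.1) (fun i => (i.2 : Measure (X i.1)))
      (fun i x => (i.1 : ℝ) • Shat i.1 x) S₀ := by
  -- In finite dimension the matrix-to-operator isomorphism is continuous both ways, so consistency
  -- in spectral norm becomes convergence in the matrix topology.
  let e := (Matrix.toEuclideanCLM (n := Fin d) (𝕜 := ℝ)).toAlgEquiv.toLinearEquiv
  have he : Continuous e := LinearMap.continuous_of_finiteDimensional e.toLinearMap
  have he' : Continuous e.symm := LinearMap.continuous_of_finiteDimensional e.symm.toLinearMap
  have h : TendstoInProb (U : Filter (Σ n, ProbabilityMeasure (X n)))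
      (Ω := fun i => X i.1) (fun i => (i.2 : Measure (X i.1)))
      (fun i x => e ((i.1 : ℝ) • Shat i.1 x)) (e S₀) := by
    refine TendstoInProb.of_norm_sub (b := fun i => e (S i.1 i.2)) (fun ε hε => ?_)
      ((he.tendsto _).comp hS₀)
    have := tendsto_ultrafilter_of_tendsto_iSup (h₂ ε hε) hfst hmem
    refine this.congr fun i => ?_
    congr 1
    ext x
    rw [Set.mem_ofPred_eq, Set.mem_ofPred_eq, ← map_sub]
    rfl
  simpa using h.comp he'.continuousAt

theorem continuousAt_combVariance (l : Fin d → ℝ) (S₀ : Matrix (Fin d) (Fin d) ℝ) :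
    ContinuousAt (combVariance l) S₀ := by
  unfold combVariance
  exact Continuous.continuousAt (by fun_prop)

theorem continuousAt_regCoef {l : Fin d → ℝ} {S₀ : Matrix (Fin d) (Fin d) ℝ}
    (hv : combVariance l S₀ ≠ 0) : ContinuousAt (regCoef l) S₀ := by
  unfold regCoef
  exact ((continuousAt_combVariance l S₀).inv₀ hv).smul (Continuous.continuousAt (by fun_prop))

theorem exists_tendstoInProb_scaledCutoff (h₃ : UniformCutoffConsistency cP chat c)
    (hfst : Tendsto (fun i : Σ n, ProbabilityMeasure (X n) => i.1) U atTop)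
    (hmem : ∀ᶠ i in (U : Filter (Σ n, ProbabilityMeasure (X n))), i.2 ∈ cP i.1)
    (A : ∀ k, Matrix (Fin (m k)) (Fin d) ℝ)
    (β : ∀ n, ProbabilityMeasure (X n) → EuclideanSpace ℝ (Fin d)) :
    ∃ C : ∀ k, Fin (m k) → EReal, TendstoInProb (U : Filter (Σ n, ProbabilityMeasure (X n)))
      (Ω := fun i => X i.1) (fun i => (i.2 : Measure (X i.1)))
      (fun i x => scaledCutoff A (√(i.1 : ℝ)) (β i.1 i.2) (chat i.1 x)) C := by
  obtain ⟨hcons, lam, hlam, hbdd⟩ := h₃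
  have hc : ∀ k, ∃ c₀ : EuclideanSpace ℝ (Fin (m k)),
      Tendsto (fun i : Σ n, ProbabilityMeasure (X n) => c i.1 i.2 k) U (𝓝 c₀) := by
    intro k
    obtain ⟨c₀, -, h⟩ := (isCompact_closedBall (0 : EuclideanSpace ℝ (Fin (m k)))
      lam).ultrafilter_le_nhds (U.map fun i : Σ n, ProbabilityMeasure (X n) => c i.1 i.2 k) (by
        rw [le_principal_iff, Ultrafilter.mem_coe, Ultrafilter.mem_map]
        filter_upwards [hmem, hfst.eventually (eventually_ge_atTop 1)] with i hi hi1
        simpa using hbdd i.1 hi1 i.2 hi k)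
    exact ⟨c₀, h⟩
  choose c₀ hc₀ using hc
  have hg : ∀ k (j : Fin (m k)), ∃ g : EReal,
      Tendsto (fun i : Σ n, ProbabilityMeasure (X n) =>
        ((-(A k *ᵥ (√(i.1 : ℝ) • β i.1 i.2).ofLp) j : ℝ) : EReal)) U (𝓝 g) :=
    -- Nothing bounds `√n β(P)`; the limit exists because `EReal` is compact.
    fun k j => ⟨_, (U.map _).le_nhds_lim⟩
  choose g hg using hg
  refine ⟨fun k j => ((c₀ k j : ℝ) : EReal) + g k j,
    TendstoInProb.pi fun k => TendstoInProb.pi fun j => ?_⟩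
  have h1 : TendstoInProb (U : Filter (Σ n, ProbabilityMeasure (X n)))
      (Ω := fun i => X i.1) (fun i => (i.2 : Measure (X i.1)))
      (fun i x => √(i.1 : ℝ) • chat i.1 x k) (c₀ k) :=
    TendstoInProb.of_norm_sub (fun ε hε =>
      tendsto_ultrafilter_of_tendsto_iSup (hcons k ε hε) hfst hmem) (hc₀ k)
  have hcoord : ContinuousAt (fun z : EuclideanSpace ℝ (Fin (m k)) => ((z j : ℝ) : EReal))
      (c₀ k) := (continuous_coe_real_ereal.comp (by fun_prop)).continuousAt
  -- Addition on `EReal` is continuous here because the first summand has a finite limit.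
  exact ((h1.comp hcoord).prodMk (TendstoInProb.const (hg k j))).comp
    (f := fun p : EReal × EReal => p.1 + p.2)
    (EReal.continuousAt_add (Or.inl (EReal.coe_ne_top _)) (Or.inl (EReal.coe_ne_bot _)))

/-- Multiplying by `P(B)` clears the denominator, also when `P(B) = 0`, where both sides vanish. Two
unconditional limits then suffice. -/
theorem weightedCondError_eq {Ω : Type*} [MeasurableSpace Ω] (P : Measure Ω) [IsFiniteMeasure P]
    {E B : Set Ω} (hB : MeasurableSet B) (p : ℝ) :
    weightedCondError P E B p = |P.real (E ∩ B) - p * P.real B| := by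
  have hcond : (ProbabilityTheory.cond P B).real E = (P.real B)⁻¹ * P.real (B ∩ E) := by
    rw [measureReal_def, cond_apply hB, ENNReal.toReal_mul, ENNReal.toReal_inv]
    rfl
  rw [weightedCondError, hcond, Set.inter_comm E B]
  rcases (measureReal_nonneg (μ := P) (s := B)).eq_or_lt with h0 | hpos
  · have : P.real (B ∩ E) = 0 := le_antisymm
      ((measureReal_mono Set.inter_subset_left).trans h0.ge) measureReal_nonneg
    simp [← h0, this]
  · conv_lhs => rw [← abs_of_pos hpos, ← abs_mul, abs_of_pos hpos, sub_mul]
    rw [mul_right_comm, inv_mul_cancel₀ hpos.ne', one_mul]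

theorem measurableSet_mem_polyhedralUnion {Ω : Type*} [MeasurableSpace Ω]
    {bhat : Ω → EuclideanSpace ℝ (Fin d)} {chat : Ω → ∀ k, EuclideanSpace ℝ (Fin (m k))}
    (hbhat : Measurable bhat) (hchat : ∀ k, Measurable fun x => chat x k) :
    MeasurableSet {x | bhat x ∈ polyhedralUnion A (chat x)} := by
  have h : {x | bhat x ∈ polyhedralUnion A (chat x)} =
      ⋃ k, ⋂ j, {x | (A k *ᵥ (bhat x).ofLp) j ≤ chat x k j} := by
    ext x
    simp [polyhedralUnion]
  rw [h]
  refine MeasurableSet.iUnion fun k => MeasurableSet.iInter fun j => ?_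
  have hl : Measurable fun z : EuclideanSpace ℝ (Fin d) => (A k *ᵥ z.ofLp) j :=
    Continuous.measurable (by fun_prop)
  have hr : Measurable fun z : EuclideanSpace ℝ (Fin (m k)) => z j :=
    Continuous.measurable (by fun_prop)
  exact measurableSet_le (hl.comp hbhat) (hr.comp (hchat k))

/-- Events that occur when the normalized truncated normal distribution function at the true
parameter lies in `(a, b)`, and do not occur when it lies outside `[a, b]`, have asymptotic
conditional probability `b - a`, uniformly. -/
theorem uniformCondLimit_of_insideSet_outsideSet (hl : l ≠ 0) (hA : ∀ k j, A k j ≠ 0)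
    (hbhat : ∀ n, Measurable (bhat n)) (hchat : ∀ n k, Measurable fun x => chat n x k)
    (h₁ : UniformAsymptoticNormality cP bhat β S) (h₂ : UniformCovarianceConsistency cP Shat S)
    (h₃ : UniformCutoffConsistency cP chat c) {a b : ℝ} (ha : 0 ≤ a) (hab : a ≤ b) (hb : b ≤ 1)
    {E : ∀ n, ProbabilityMeasure (X n) → Set (X n)}
    (hin : ∀ n : ℕ, 1 ≤ n → ∀ P x, (√(n : ℝ) • bhat n x - √(n : ℝ) • β n P,
      scaledParam A l n (Shat n x) (β n P) (chat n x)) ∈ insideSet A l a b → x ∈ E n P)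
    (hout : ∀ n : ℕ, 1 ≤ n → ∀ P x, bhat n x ∈ polyhedralUnion A (chat n x) →
      (√(n : ℝ) • bhat n x - √(n : ℝ) • β n P,
      scaledParam A l n (Shat n x) (β n P) (chat n x)) ∈ outsideSet A l a b → x ∉ E n P) :
    UniformCondLimit cP E (fun n => {x | bhat n x ∈ polyhedralUnion A (chat n x)}) (b - a) := by
  refine tendsto_iSup_of_tendsto_ultrafilter fun U hfst hmem => ?_
  obtain ⟨S₀, a₀, ha₀, hpsd, hS₀, hconv⟩ := exists_tendsto_of_uniformAsymptoticNormality h₁ hfst hmem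
  obtain ⟨C, hC⟩ := exists_tendstoInProb_scaledCutoff h₃ hfst hmem A β
  have hS := tendstoInProb_of_uniformCovarianceConsistency h₂ hfst hmem hS₀
  have hpos : ∀ x : Fin d → ℝ, x ≠ 0 → 0 < x ⬝ᵥ (S₀ *ᵥ x) := fun x hx =>
    dotProduct_mulVec_pos_of_sub_smul_one ha₀ hpsd hx
  have hS₀' := posSemidef_of_sub_smul_one ha₀.le hpsd
  have hv : 0 < combVariance l S₀ := hpos l hl
  have hθ : TendstoInProb (U : Filter (Σ n, ProbabilityMeasure (X n)))
      (Ω := fun i => X i.1) (fun i => (i.2 : Measure (X i.1)))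
      (fun i x => scaledParam A l i.1 (Shat i.1 x) (β i.1 i.2) (chat i.1 x))
      ((regCoef l S₀, combVariance l S₀, C) : LineParam d m) :=
    (hS.comp (continuousAt_regCoef hv.ne')).prodMk
      ((hS.comp (continuousAt_combVariance l S₀)).prodMk hC)
  have hYm : ∀ i : Σ n, ProbabilityMeasure (X n),
      Measurable fun x : X i.1 => √(i.1 : ℝ) • bhat i.1 x - √(i.1 : ℝ) • β i.1 i.2 := fun i =>
    (hbhat i.1).const_smul (√(i.1 : ℝ)) |>.sub_const (√(i.1 : ℝ) • β i.1 i.2)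
  have hB : ∀ n, MeasurableSet {x | bhat n x ∈ polyhedralUnion A (chat n x)} := fun n =>
    measurableSet_mem_polyhedralUnion (hbhat n) (hchat n)
  have h1 : ∀ᶠ i in (U : Filter (Σ n, ProbabilityMeasure (X n))), 1 ≤ i.1 :=
    hfst.eventually (eventually_ge_atTop 1)
  have hr : ∀ n : ℕ, 1 ≤ n → 0 < √(n : ℝ) := fun n hn =>
    Real.sqrt_pos.2 (by exact_mod_cast hn)
  have key₁ := tendsto_measureReal_of_mem_nhds (μ := fun i => (i.2 : Measure (X i.1)))
    (W := fun i => E i.1 i.2 ∩ {x | bhat i.1 x ∈ polyhedralUnion A (chat i.1 x)})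
    hYm hconv hθ (G₁ := insideSet A l a b) (G₀ := outsideSet A l a b)
    (by
      filter_upwards [h1] with i hi x hx
      exact ⟨hin i.1 hi i.2 x hx, (smul_sub_smul_mem_extPolyhedralUnion (hr i.1 hi)).1 hx.1.1⟩)
    (by
      filter_upwards [h1] with i hi x hx hW
      exact hout i.1 hi i.2 x hW.2 hx hW.1)
    (ae_insideSet_or_outsideSet hpos hS₀' hA hl ha hab hb)
  rw [multivariateGaussian_insideSet hpos hS₀' hA hl ha hab hb] at key₁
  -- The same mapping theorem for the conditioning event alone, whose limit is `P(y ∈ Q)`; the event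
  -- intersected with it has limit `(b - a) P(y ∈ Q)`.
  have key₂ := tendsto_measureReal_of_mem_nhds (μ := fun i => (i.2 : Measure (X i.1)))
    (W := fun i => {x | bhat i.1 x ∈ polyhedralUnion A (chat i.1 x)})
    hYm hconv hθ (G₁ := {p | p.1 ∈ extPolyhedralUnion A p.2.2.2})
    (G₀ := {p | p.1 ∉ extPolyhedralUnion A p.2.2.2})
    (by
      filter_upwards [h1] with i hi x hx
      exact (smul_sub_smul_mem_extPolyhedralUnion (hr i.1 hi)).1 hx)
    (by
      filter_upwards [h1] with i hi x hx hW
      exact hx ((smul_sub_smul_mem_extPolyhedralUnion (hr i.1 hi)).2 hW))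
    (by
      filter_upwards [ae_mulVec_ne hpos hS₀' hA C] with y hy
      have hev := eventually_mem_extPolyhedralUnion_iff_prod (A := A) (y := y)
        (θ := ((regCoef l S₀, combVariance l S₀, C) : LineParam d m)) hy
      by_cases hyC : y ∈ extPolyhedralUnion A C
      · exact Or.inl (by filter_upwards [hev] with p hp using hp.2 hyC)
      · exact Or.inr (by filter_upwards [hev] with p hp using mt hp.1 hyC))
  have hQ : (multivariateGaussian 0 S₀).real {y | {p : EuclideanSpace ℝ (Fin d) × LineParam d m |
      p.1 ∈ extPolyhedralUnion A p.2.2.2} ∈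
        𝓝 (y, ((regCoef l S₀, combVariance l S₀, C) : LineParam d m))} =
      (multivariateGaussian 0 S₀).real (extPolyhedralUnion A C) := by
    refine measureReal_congr ?_
    filter_upwards [ae_mulVec_ne hpos hS₀' hA C] with y hy
    refine propext ⟨fun h => mem_of_mem_nhds (x := (y, _)) h, fun h => ?_⟩
    have hev := eventually_mem_extPolyhedralUnion_iff_prod (A := A) (y := y)
      (θ := ((regCoef l S₀, combVariance l S₀, C) : LineParam d m)) hy
    change {p : EuclideanSpace ℝ (Fin d) × LineParam d m | _} ∈ 𝓝 _
    filter_upwards [hev] with p hp using hp.2 h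
  rw [hQ] at key₂
  have hlim := (key₁.sub (key₂.const_mul (b - a))).abs
  rw [sub_self, abs_zero] at hlim
  have hlim' := ENNReal.tendsto_ofReal hlim
  rw [ENNReal.ofReal_zero] at hlim'
  refine hlim'.congr fun i => ?_
  rw [weightedCondError_eq _ (hB i.1)]

theorem IsPlugInQuantile.lt_and_gt {Ω : Type*} {bhat : Ω → EuclideanSpace ℝ (Fin d)}
    {Shat : Ω → Matrix (Fin d) (Fin d) ℝ} {chat : Ω → ∀ k, EuclideanSpace ℝ (Fin (m k))} {α : ℝ}
    {mu : Ω → ℝ} (hmu : IsPlugInQuantile A l bhat Shat chat α mu) (hα : α ∈ Set.Ioo (0 : ℝ) 1)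
    {n : ℕ} (hn : 1 ≤ n) {β : EuclideanSpace ℝ (Fin d)} {x : Ω}
    {p : EuclideanSpace ℝ (Fin d) × LineParam d m}
    (hp : p = (√(n : ℝ) • bhat x - √(n : ℝ) • β, scaledParam A l n (Shat x) β (chat x)))
    (h : p ∈ regularSet A l) :
    ((1 - α) * lineDenom (extPolyhedralUnion A p.2.2.2) l p.2.1 p.2.2.1 p.1 <
      lineNumer (extPolyhedralUnion A p.2.2.2) l p.2.1 p.2.2.1 p.1 → l ⬝ᵥ β.ofLp < mu x) ∧
    (lineNumer (extPolyhedralUnion A p.2.2.2) l p.2.1 p.2.2.1 p.1 <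
      (1 - α) * lineDenom (extPolyhedralUnion A p.2.2.2) l p.2.1 p.2.2.1 p.1 →
        mu x < l ⬝ᵥ β.ofLp) := by
  subst hp
  have hq : 1 - α ∈ Set.Ioo (0 : ℝ) 1 := ⟨by linarith [hα.2], by linarith [hα.1]⟩
  obtain ⟨hex, hu⟩ := mul_lineDenom_lt_lineNumer_imp hn h hq
  exact hu (mu x) (hmu x ((smul_sub_smul_mem_extPolyhedralUnion
    (Real.sqrt_pos.2 (by exact_mod_cast hn))).1 h.1) hex)

end Assembly

theorem propositionD
    -- sample spaces and classes of distributions of a sample of size `n`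
    {X : ℕ → Type*} [∀ n, MeasurableSpace (X n)]
    (cP : ∀ n, Set (ProbabilityMeasure (X n)))
    -- the parameter of interest is `l' β(P)` with `l ≠ 0`
    {d : ℕ} (l : Fin d → ℝ) (hl : l ≠ 0)
    -- `K ≥ 1` polyhedra, given by nonrandom matrices with nonzero rows
    {K : ℕ} (hK : 1 ≤ K) {m : Fin K → ℕ}
    (A : ∀ k, Matrix (Fin (m k)) (Fin d) ℝ) (hA : ∀ k j, A k j ≠ 0)
    -- estimators, covariance estimators and estimated cutoffs
    (bhat : ∀ n, X n → EuclideanSpace ℝ (Fin d)) (hbhat : ∀ n, Measurable (bhat n))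
    (Shat : ∀ n, X n → Matrix (Fin d) (Fin d) ℝ)
    (hShat : ∀ n i j, Measurable fun x => Shat n x i j)
    (chat : ∀ n, X n → ∀ k, EuclideanSpace ℝ (Fin (m k)))
    (hchat : ∀ n k, Measurable fun x => chat n x k)
    -- centering vectors, asymptotic covariance matrices, limiting cutoffs
    (β : ∀ n, ProbabilityMeasure (X n) → EuclideanSpace ℝ (Fin d))
    (S : ∀ n, ProbabilityMeasure (X n) → Matrix (Fin d) (Fin d) ℝ)
    (c : ∀ n, ProbabilityMeasure (X n) → ∀ k, EuclideanSpace ℝ (Fin (m k)))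
    -- the three assumptions
    (h₁ : UniformAsymptoticNormality cP bhat β S)
    (h₂ : UniformCovarianceConsistency cP Shat S)
    (h₃ : UniformCutoffConsistency cP chat c)
    -- the plug-in quantile estimators, for every level in `(0, 1)`
    (mu : ℝ → ∀ n, X n → ℝ)
    (hmu : ∀ α ∈ Set.Ioo (0 : ℝ) 1, ∀ n,
      IsPlugInQuantile A l (bhat n) (Shat n) (chat n) α (mu α n)) :
    -- validity of the quantile estimators
    (∀ α ∈ Set.Ioo (0 : ℝ) 1, UniformCondLimit cP
      (fun n P => {x | l ⬝ᵥ (β n P).ofLp ≤ mu α n x})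
      (fun n => {x | bhat n x ∈ polyhedralUnion A (chat n x)}) α) ∧
    -- validity of the confidence intervals
    (∀ α ∈ Set.Ioo (0 : ℝ) 1, UniformCondLimit cP
      (fun n P => {x | l ⬝ᵥ (β n P).ofLp ∈ Set.Icc (mu (α / 2) n x) (mu (1 - α / 2) n x)})
      (fun n => {x | bhat n x ∈ polyhedralUnion A (chat n x)}) (1 - α)) ∧
    -- validity of the median unbiased estimators
    UniformCondLimit cP
      (fun n P => {x | l ⬝ᵥ (β n P).ofLp ≤ mu (1 / 2) n x})
      (fun n => {x | bhat n x ∈ polyhedralUnion A (chat n x)}) (1 / 2) := by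
  have hquant : ∀ α ∈ Set.Ioo (0 : ℝ) 1, UniformCondLimit cP
      (fun n P => {x | l ⬝ᵥ (β n P).ofLp ≤ mu α n x})
      (fun n => {x | bhat n x ∈ polyhedralUnion A (chat n x)}) α := by
    intro α hα
    -- The event `l' β ≤ μ̂*_α` corresponds to `N / D` in `(1 - α, 1)`. The side above `b = 1` is
    -- vacuous, since `N < D` at regular points.
    have h := uniformCondLimit_of_insideSet_outsideSet hl hA hbhat hchat h₁ h₂ h₃
      (a := 1 - α) (b := 1) (E := fun n P => {x | l ⬝ᵥ (β n P).ofLp ≤ mu α n x})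
      (by linarith [hα.2]) (by linarith [hα.1]) le_rfl
      (fun n hn P x hx => (((hmu α hα n).lt_and_gt hα hn rfl hx.1).1 hx.2.1).le)
      (fun n hn P x hxB hx hxE => by
        rcases hx with hx | ⟨hr, hx | hx⟩
        · exact hx ((smul_sub_smul_mem_extPolyhedralUnion
            (Real.sqrt_pos.2 (by exact_mod_cast hn))).2 hxB)
        · exact (((hmu α hα n).lt_and_gt hα hn rfl hr).2 hx).not_ge hxE
        · rw [one_mul] at hx
          exact hx.not_gt hr.2.2.2)
    rwa [sub_sub_cancel] at h
  refine ⟨hquant, fun α hα => ?_, hquant _ ⟨by norm_num, by norm_num⟩⟩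
  have hα₁ : α / 2 ∈ Set.Ioo (0 : ℝ) 1 := ⟨by linarith [hα.1], by linarith [hα.2]⟩
  have hα₂ : 1 - α / 2 ∈ Set.Ioo (0 : ℝ) 1 := ⟨by linarith [hα.2], by linarith [hα.1]⟩
  have hsub : 1 - (1 - α / 2) = α / 2 := by ring
  -- Coverage corresponds to `N / D` in `(α/2, 1 - α/2)`: the lower endpoint gives the upper bound
  -- on `N / D`, and the upper endpoint the lower bound.
  have h := uniformCondLimit_of_insideSet_outsideSet hl hA hbhat hchat h₁ h₂ h₃
    (a := α / 2) (b := 1 - α / 2)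
    (E := fun n P => {x | l ⬝ᵥ (β n P).ofLp ∈ Set.Icc (mu (α / 2) n x) (mu (1 - α / 2) n x)})
    hα₁.1.le (by linarith [hα.2]) hα₂.2.le
    (fun n hn P x hx => ⟨(((hmu _ hα₁ n).lt_and_gt hα₁ hn rfl hx.1).2 hx.2.2).le,
      (((hmu _ hα₂ n).lt_and_gt hα₂ hn rfl hx.1).1 (by rw [hsub]; exact hx.2.1)).le⟩)
    (fun n hn P x hxB hx hxE => by
      rcases hx with hx | ⟨hr, hx | hx⟩
      · exact hx ((smul_sub_smul_mem_extPolyhedralUnion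
          (Real.sqrt_pos.2 (by exact_mod_cast hn))).2 hxB)
      · exact (((hmu _ hα₂ n).lt_and_gt hα₂ hn rfl hr).2 (by rw [hsub]; exact hx)).not_ge hxE.2
      · exact (((hmu _ hα₁ n).lt_and_gt hα₁ hn rfl hr).1 hx).not_ge hxE.1)
  rwa [show 1 - α / 2 - α / 2 = 1 - α by ring] at h

end
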